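/- **Setting.** Let $\mu$ be a probability measure on $\mathbb R^n$, and let $L^2(\mu,\wedge^k\mathbb C^n)$ be the Hilbert space of $k$-forms $u=\sum_{j_1<\dots<j_k}u_{j_1\dots j_k}\,dz^{j_1}\wedge\dots\wedge dz^{j_k}$ with coefficients in $L^2(\mu)$ and $\|u\|_\mu^2=\int\sum|u_{j_1\dots j_k}|^2\,d\mu$. Let $d_k$ be the exterior differential from $L^2(\mu,\wedge^k\mathbb C^n)$ to $L^2(\mu,\wedge^{k+1}\mathbb C^n)$ with its maximal domain: $u\in D(d_k)$ and $d_ku=f$ mean that $u$ and $f$ are represented by locally (Lebesgue) integrable forms on $\mathbb R^n$ satisfying $du=f$ in the sense of distributions. Write $D$, $R$, $Z$ for domain, range and kernel. Put $d_{-1}=0$, let $d_k^*$ be the Hilbert space adjoint, $X_{k+1}=\overline{R(d_k)}$, and let $$A_k=d_k^*d_k+d_{k-1}d_{k-1}^*,\qquad D(A_k)=D(d_k^*d_k)\cap D(d_{k-1}d_{k-1}^*),$$ where products have their natural domains. **Theorem.** Fix $k\ge 0$, and let $\mu$ be any probability measure on $\mathbb R^n$ for which the maximal differentials entering in $A_k$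 and $A_{k+1}$ (that is $d_{k-1}$, if $k\geq1$, $d_k$ and $d_{k+1}$) are closed operators, i.e. have single-valued and closed graphs. Then $Z(d_k)^\perp$ is invariant under $A_k$, $X_{k+1}$ is invariant under $A_{k+1}$, and $A_{k+1}|_{X_{k+1}}$ is injective. The following properties are equivalent: 1. $R(A_k|_{Z(d_k)^\perp})$ is closed; 2. $R(d_k)$ is closed; 3. $R(d_k^*)$ is closed; 4. $A_{k+1}|_{X_{k+1}}$ is strictly positive, i.e. there is $c>0$ with $\langle A_{k+1}v,v\rangle_\mu\ge c\|v\|_\mu^2$ for all $v\in D(A_{k+1})\cap X_{k+1}$; 5. $P_k=d_k^*(A_{k+1}|_{X_{k+1}})^{-1}d_k$ on all of $D(d_k)$, where $P_k$ is the orthogonal projection onto the closure of $R(A_k|_{Z(d_k)^\perp})$. If $R(A_k)$ is closed, these properties hold; and for $k=0$ one has $R(A_0)=R(A_0|_{Z(d_0)^\perp})$, so that $R(A_0)$ may replace $R(A_0|_{Z(d_0)^\perp})$ everywhere. In the affirmative case $A_k|_{Z(d_k)^\perp}=d_k^*d_k|_{Z(d_k)^\perp}$, its (closed) range equals $R(d_k^*)$,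 and $A_{k+1}|_{X_{k+1}}=d_kd_k^*|_{X_{k+1}}$. Moreover, $d_k^*d_k|_{Z(d_k)^\perp}$ has a unique nonnegative self-adjoint square root, this is injective, the operator $U=d_k\,(d_k^*d_k|_{Z(d_k)^\perp})^{-1/2}$ is everywhere defined and unitary from $Z(d_k)^\perp$ onto $X_{k+1}$, and $$A_k|_{Z(d_k)^\perp}=U^*\,A_{k+1}|_{X_{k+1}}\,U$$ as unbounded operators (domains included). Consequently $$\sigma(A_k|_{Z(d_k)^\perp})=\sigma(A_{k+1}|_{X_{k+1}}),\qquad \sigma_{\mathrm{ess}}(A_k|_{Z(d_k)^\perp})=\sigma_{\mathrm{ess}}(A_{k+1}|_{X_{k+1}}),$$ where $\sigma_{\mathrm{ess}}$ is the spectrum without its isolated points that are eigenvalues of finite multiplicity. -/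

import Mathlib

open MeasureTheory Filter Topology

noncomputable section

namespace UnboundedOp

variable {E F G : Type*}
  [NormedAddCommGroup E] [InnerProductSpace ℂ E]
  [NormedAddCommGroup F] [InnerProductSpace ℂ F]
  [NormedAddCommGroup G] [InnerProductSpace ℂ G]

/-- The range `R(T)`. -/
def range (T : E →ₗ.[ℂ] F) : Submodule ℂ F := LinearMap.range T.toFun

/-- The kernel `Z(T)`, a subspace of the ambient space. -/
def ker (T : E →ₗ.[ℂ] F) : Submodule ℂ E := (LinearMap.ker T.toFun).map T.domain.subtype

/-- An everywhere defined linear map, regarded as a partially defined one. -/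
def total (f : E →ₗ[ℂ] F) : E →ₗ.[ℂ] F := f.toPMap ⊤

/-- The product `S T` of unbounded operators with its natural domain
`{x ∈ D(T) | T x ∈ D(S)}`. -/
def comp (S : F →ₗ.[ℂ] G) (T : E →ₗ.[ℂ] F) : E →ₗ.[ℂ] G where
  domain := (S.domain.comap T.toFun).map T.domain.subtype
  toFun :=
    { toFun := fun x => S ⟨T ⟨x.1, by
          obtain ⟨y, -, hy⟩ := x.2
          exact hy ▸ y.2⟩, by
          obtain ⟨y, hy, h⟩ := x.2
          have : y = ⟨x.1, h ▸ y.2⟩ := Subtype.ext h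
          exact this ▸ hy⟩
      map_add' := by
        intro x y
        rw [← LinearPMap.map_add]
        congr 1
        apply Subtype.ext
        change T _ = T _ + T _
        rw [← LinearPMap.map_add]
        rfl
      map_smul' := by
        intro c x
        rw [RingHom.id_apply, ← LinearPMap.map_smul]
        congr 1
        apply Subtype.ext
        change T _ = c • T _
        rw [← LinearPMap.map_smul]
        rfl }

/-- The restriction `A|_K` of an operator `A` in `E` to a subspace `K`, regarded as an operator
in `K`: its domain is `{x ∈ D(A) ∩ K | A x ∈ K}`. When `K` is invariant under `A` this is
`D(A) ∩ K`. -/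
def part (A : E →ₗ.[ℂ] E) (K : Submodule ℂ E) : K →ₗ.[ℂ] K where
  domain := ((K.comap A.toFun).map A.domain.subtype).comap K.subtype
  toFun :=
    { toFun := fun x => ⟨A ⟨x.1.1, by
          obtain ⟨y, -, hy⟩ := x.2
          have hy : (y : E) = x.1.1 := hy
          exact hy ▸ y.2⟩, by
          obtain ⟨y, hy, h⟩ := x.2
          have h : (y : E) = x.1.1 := h
          have : y = ⟨x.1.1, h ▸ y.2⟩ := Subtype.ext h
          exact this ▸ hy⟩
      map_add' := by
        intro x y
        apply Subtype.ext
        change A _ = A _ + A _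
        rw [← LinearPMap.map_add]
        rfl
      map_smul' := by
        intro c x
        apply Subtype.ext
        change A _ = c • A _
        rw [← LinearPMap.map_smul]
        rfl }

/-- `K` is invariant under `A`: `A` maps `D(A) ∩ K` into `K`. -/
def IsInvariant (A : E →ₗ.[ℂ] E) (K : Submodule ℂ E) : Prop :=
  ∀ x : A.domain, (x : E) ∈ K → A x ∈ K

/-- The range of `A|_K`, as a subspace of the ambient space. -/
def partRange (A : E →ₗ.[ℂ] E) (K : Submodule ℂ E) : Submodule ℂ E :=
  (range (part A K)).map K.subtype

/-- Strict positivity of `A`: its lower bound `inf {Re ⟪A x, x⟫ | x ∈ D(A), ‖x‖ = 1}`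
is positive. -/
def IsStrictlyPositive (A : E →ₗ.[ℂ] E) : Prop :=
  ∃ c : ℝ, 0 < c ∧ ∀ x : A.domain, c * ‖(x : E)‖ ^ 2 ≤ (inner ℂ (x : E) (A x)).re

/-- `Q` is the nonnegative self-adjoint square root `A^{1/2}`. -/
def IsSqrt [CompleteSpace E] (A Q : E →ₗ.[ℂ] E) : Prop :=
  IsSelfAdjoint Q ∧ (∀ x : Q.domain, 0 ≤ (inner ℂ (x : E) (Q x)).re) ∧ comp Q Q = A

/-- `z` is in the resolvent set: `A - z` is a bijection from `D(A)` onto the space, with a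
bounded inverse `R`. -/
def IsResolventPoint (A : E →ₗ.[ℂ] E) (z : ℂ) : Prop :=
  ∃ R : E →L[ℂ] E,
    (∀ y : E, ∃ x : A.domain, (x : E) = R y ∧ A x - z • (x : E) = y) ∧
    ∀ x : A.domain, R (A x - z • (x : E)) = x

/-- The spectrum of an unbounded operator. -/
def spectrum (A : E →ₗ.[ℂ] E) : Set ℂ := {z | ¬ IsResolventPoint A z}

/-- The eigenspace `Z(A - z)`. -/
def eigenspace (A : E →ₗ.[ℂ] E) (z : ℂ) : Submodule ℂ E :=
  (LinearMap.ker (A.toFun - z • A.domain.subtype)).map A.domain.subtype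

/-- The discrete spectrum: isolated points of the spectrum that are eigenvalues of finite
multiplicity. -/
def discreteSpectrum (A : E →ₗ.[ℂ] E) : Set ℂ :=
  {z | z ∈ spectrum A ∧ (∃ ε : ℝ, 0 < ε ∧ ∀ w ∈ spectrum A, dist w z < ε → w = z) ∧
    eigenspace A z ≠ ⊥ ∧ FiniteDimensional ℂ (eigenspace A z)}

/-- The essential spectrum. -/
def essentialSpectrum (A : E →ₗ.[ℂ] E) : Set ℂ := spectrum A \ discreteSpectrum A

end UnboundedOp

namespace DeRham

/-- `ℝⁿ`. -/
abbrev Space (n : ℕ) : Type := EuclideanSpace ℝ (Fin n)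

/-- `⋀ᵏ ℂⁿ` through the coefficients `v_J` of `∑ v_J dz^J`, where `J` runs over the strictly
increasing `k`-tuples, with norm `(∑ |v_J|²)^{1/2}`. -/
abbrev Form (n k : ℕ) : Type := EuclideanSpace ℂ (Fin k ↪o Fin n)

/-- The Hilbert space `L²(μ, ⋀ᵏ ℂⁿ)`. -/
abbrev L2 {n : ℕ} (μ : Measure (Space n)) (k : ℕ) : Type := Lp (Form n k) 2 μ

/-- The distribution `∂_j u`, evaluated at the test function `φ`: `-∫ u ∂_j φ dx`. -/
def weakPartial {n : ℕ} (u : Space n → ℂ) (j : Fin n) (φ : Space n → ℂ) : ℂ :=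
  -∫ x, u x * fderiv ℝ φ x (EuclideanSpace.single j 1)

/-- `d u = f` in the sense of distributions on `ℝⁿ`, for a `k`-form `u` and a `(k+1)`-form `f`
with locally integrable coefficients. The coefficient of `d u` at `K = (j_0 < ⋯ < j_k)` is
`∑ i, (-1)^i ∂_{j_i} u_{K ∖ j_i}`. -/
def IsWeakD {n k : ℕ} (u : Space n → Form n k) (f : Space n → Form n (k + 1)) : Prop :=
  ∀ φ : Space n → ℂ, ContDiff ℝ (⊤ : ℕ∞) φ → HasCompactSupport φ →
    ∀ K : Fin (k + 1) ↪o Fin n,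
      ∫ x, f x K * φ x =
        ∑ i : Fin (k + 1), (-1 : ℂ) ^ (i : ℕ) *
          weakPartial (fun x => u x ((Fin.succAboveOrderEmb i).trans K)) (K i) φ

theorem locInt_coord {n k : ℕ} {u : Space n → Form n k} (hu : LocallyIntegrable u volume)
    (J : Fin k ↪o Fin n) : LocallyIntegrable (fun x => u x J) volume := by
  intro x
  obtain ⟨s, hs, h⟩ := hu x
  exact ⟨s, hs, (EuclideanSpace.proj (𝕜 := ℂ) J).integrable_comp h⟩

theorem locInt_mul {n : ℕ} {v : Space n → ℂ} (hv : LocallyIntegrable v volume)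
    {φ : Space n → ℂ} (hφ : Continuous φ) (hc : HasCompactSupport φ) :
    Integrable (fun x => v x * φ x) volume := by
  simpa [smul_eq_mul, mul_comm] using
    hv.integrable_smul_left_of_hasCompactSupport hφ hc

theorem locInt_mul_fderiv {n : ℕ} {v : Space n → ℂ} (hv : LocallyIntegrable v volume)
    {φ : Space n → ℂ} (hφ : ContDiff ℝ (⊤ : ℕ∞) φ) (hc : HasCompactSupport φ) (e : Space n) :
    Integrable (fun x => v x * fderiv ℝ φ x e) volume :=
  locInt_mul hv ((hφ.continuous_fderiv (by simp)).clm_apply continuous_const)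
    (hc.fderiv_apply (𝕜 := ℝ) e)

/-- The graph of `d_k` with its maximal domain: the pairs `(u, f)` in
`L²(μ, ⋀ᵏ ℂⁿ) × L²(μ, ⋀ᵏ⁺¹ ℂⁿ)` with `d u = f` in the sense of distributions. An element
of `L²(μ)` acts as a distribution through a locally integrable function that represents it. -/
def maxGraph {n : ℕ} (μ : Measure (Space n)) (k : ℕ) : Submodule ℂ (L2 μ k × L2 μ (k + 1)) where
  carrier := {p | ∃ (u : Space n → Form n k) (f : Space n → Form n (k + 1)),
    LocallyIntegrable u volume ∧ LocallyIntegrable f volume ∧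
    p.1 =ᵐ[μ] u ∧ p.2 =ᵐ[μ] f ∧ IsWeakD u f}
  zero_mem' := by
    refine ⟨0, 0, locallyIntegrable_zero, locallyIntegrable_zero, Lp.coeFn_zero _ _ _,
      Lp.coeFn_zero _ _ _, ?_⟩
    intro φ _ _ K
    simp [weakPartial]
  add_mem' := by
    rintro p q ⟨u, f, hu, hf, hpu, hpf, h⟩ ⟨v, g, hv, hg, hqv, hqg, h'⟩
    refine ⟨u + v, f + g, hu.add hv, hf.add hg, (Lp.coeFn_add _ _).trans (hpu.add hqv),
      (Lp.coeFn_add _ _).trans (hpf.add hqg), ?_⟩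
    intro φ hφ hc K
    have e1 : ∫ x, (f + g) x K * φ x = (∫ x, f x K * φ x) + ∫ x, g x K * φ x := by
      rw [← integral_add (locInt_mul (locInt_coord hf K) hφ.continuous hc)
        (locInt_mul (locInt_coord hg K) hφ.continuous hc)]
      simp [add_mul]
    rw [e1, h φ hφ hc K, h' φ hφ hc K, ← Finset.sum_add_distrib]
    refine Finset.sum_congr rfl fun i _ => ?_
    rw [← mul_add]
    congr 1
    unfold weakPartial
    rw [← neg_add, ← integral_add (locInt_mul_fderiv (locInt_coord hu _) hφ hc _)
        (locInt_mul_fderiv (locInt_coord hv _) hφ hc _)]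
    simp [add_mul]
  smul_mem' := by
    rintro c p ⟨u, f, hu, hf, hpu, hpf, h⟩
    refine ⟨c • u, c • f, hu.smul c, hf.smul c, (Lp.coeFn_smul _ _).trans (hpu.const_smul c),
      (Lp.coeFn_smul _ _).trans (hpf.const_smul c), ?_⟩
    intro φ hφ hc K
    simp only [weakPartial, Pi.smul_apply, PiLp.smul_apply, smul_eq_mul, mul_assoc,
      integral_const_mul]
    have := h φ hφ hc K
    simp only [weakPartial] at this
    rw [this, Finset.mul_sum]
    refine Finset.sum_congr rfl fun i _ => ?_
    ring

/-- The maximal realization of `d_k` is a closed operator: its graph is single valued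
and closed. -/
def IsClosedOperator {n : ℕ} (μ : Measure (Space n)) (k : ℕ) : Prop :=
  (∀ f : L2 μ (k + 1), ((0 : L2 μ k), f) ∈ maxGraph μ k → f = 0) ∧
    IsClosed (maxGraph μ k : Set (L2 μ k × L2 μ (k + 1)))

/-- The exterior differential `d_k` from `L²(μ, ⋀ᵏ ℂⁿ)` to `L²(μ, ⋀ᵏ⁺¹ ℂⁿ)` with its maximal
domain. -/
def d {n : ℕ} (μ : Measure (Space n)) (k : ℕ) : L2 μ k →ₗ.[ℂ] L2 μ (k + 1) :=
  (maxGraph μ k).toLinearPMap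

/-- The Hilbert space adjoint `d_k^*`. -/
def dStar {n : ℕ} (μ : Measure (Space n)) (k : ℕ) : L2 μ (k + 1) →ₗ.[ℂ] L2 μ k :=
  (d μ k).adjoint

/-- `d_k^* d_k`, with natural domain. -/
def dStarD {n : ℕ} (μ : Measure (Space n)) (k : ℕ) : L2 μ k →ₗ.[ℂ] L2 μ k :=
  UnboundedOp.comp (dStar μ k) (d μ k)

/-- `d_k d_k^*`, with natural domain. -/
def dDStar {n : ℕ} (μ : Measure (Space n)) (k : ℕ) : L2 μ (k + 1) →ₗ.[ℂ] L2 μ (k + 1) :=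
  UnboundedOp.comp (d μ k) (dStar μ k)

/-- The Hodge Laplacian `A_k = d_k^* d_k + d_{k-1} d_{k-1}^*`, with domain
`D(d_k^* d_k) ∩ D(d_{k-1} d_{k-1}^*)`; here `d_{-1} = 0`. -/
def hodge {n : ℕ} (μ : Measure (Space n)) : (k : ℕ) → L2 μ k →ₗ.[ℂ] L2 μ k
  | 0 => dStarD μ 0
  | k + 1 => dStarD μ (k + 1) + dDStar μ k

/-- `Z(d_k)^⊥ = L²(μ, ⋀ᵏ ℂⁿ) ⊖ Z(d_k)`. -/
def kerPerp {n : ℕ} (μ : Measure (Space n)) (k : ℕ) : Submodule ℂ (L2 μ k) :=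
  (UnboundedOp.ker (d μ k))ᗮ

/-- `X_{k+1}`, the closure of `R(d_k)`. -/
def X {n : ℕ} (μ : Measure (Space n)) (k : ℕ) : Submodule ℂ (L2 μ (k + 1)) :=
  (UnboundedOp.range (d μ k)).topologicalClosure

/-- `A_k|_{Z(d_k)^⊥}`, an operator in `Z(d_k)^⊥`. -/
def lower {n : ℕ} (μ : Measure (Space n)) (k : ℕ) : kerPerp μ k →ₗ.[ℂ] kerPerp μ k :=
  UnboundedOp.part (hodge μ k) (kerPerp μ k)

/-- `A_{k+1}|_{X_{k+1}}`, an operator in `X_{k+1}`. -/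
def upper {n : ℕ} (μ : Measure (Space n)) (k : ℕ) : X μ k →ₗ.[ℂ] X μ k :=
  UnboundedOp.part (hodge μ (k + 1)) (X μ k)

instance {n : ℕ} (μ : Measure (Space n)) (k : ℕ) : CompleteSpace (kerPerp μ k) :=
  inferInstanceAs (CompleteSpace ((UnboundedOp.ker (d μ k))ᗮ : Submodule ℂ (L2 μ k)))

/-- The range of `A_k|_{Z(d_k)^⊥}` in `L²(μ, ⋀ᵏ ℂⁿ)`. -/
def lowerRange {n : ℕ} (μ : Measure (Space n)) (k : ℕ) : Submodule ℂ (L2 μ k) :=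
  UnboundedOp.partRange (hodge μ k) (kerPerp μ k)

/-- The orthogonal projection `P_k` in `L²(μ, ⋀ᵏ ℂⁿ)` onto the closure of the range of
`A_k|_{Z(d_k)^⊥}`. -/
def P {n : ℕ} (μ : Measure (Space n)) (k : ℕ) : L2 μ k →L[ℂ] L2 μ k :=
  (lowerRange μ k).topologicalClosure.starProjection

/-- The operator `d_k^* (A_{k+1}|_{X_{k+1}})⁻¹ d_k` with its natural domain. -/
def projFormula {n : ℕ} (μ : Measure (Space n)) (k : ℕ) : L2 μ k →ₗ.[ℂ] L2 μ k :=
  UnboundedOp.comp (UnboundedOp.comp (dStar μ k) (UnboundedOp.total (X μ k).subtype))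
    (UnboundedOp.comp (upper μ k).inverse
      ((d μ k).codRestrict (X μ k) fun x =>
        Submodule.le_topologicalClosure _ (LinearMap.mem_range_self (d μ k).toFun x)))

end DeRham

end

/-! Since `d ∘ d = 0`, the closure `X` of `R(d_k)` lies in `Z(d_{k+1})`, and `Z(d_k)^⊥` lies in
`Z(d_{k-1}^*)`. On each of these two spaces one term of the Hodge Laplacian vanishes. Let `S` be
`d_k` cut down to an operator from `Z(d_k)^⊥` to `X` (`reducedD`), and `S'` its counterpart for
`d_k^*` (`reducedDStar`). They are injective and adjoint to each other (`isAdjointPair_reducedD`),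
and the two restricted Laplacians are `S' S` and `S S'` (`lower_eq_comp`, `upper_eq_comp`).

All ranges involved are dense in the reduced spaces, so closed range means surjectivity, and the
equivalences become the abstract statement `IsAdjointPair.tfae_surjective`. Its tools are the
bounded operator `S S' (1 + S S')⁻¹`, which has the same range as `S S'`, and the closed graph
theorem. The projection formula amounts to `R(S) ⊆ R(S S')` (`projFormula_eq_iff`).

If `S` is onto, `K = S⁻¹` is bounded and `(S' S)⁻¹ = K K^*`. With `H = (K K^*)^{1/2}`, the polar
decomposition `K^* = U H` has a unitary factor by `exists_polar_decomposition`. The square root of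
`S' S` is `H⁻¹`, and `U = S H` carries `S' S` to `S S'`, hence spectrum to spectrum.

Unbounded operators are handled through their graphs throughout, so that domains are part of every
identity. -/

namespace UnboundedOp

/-! ### Graph descriptions of the operations on unbounded operators. -/

section Graph

variable {E F G : Type*}
  [NormedAddCommGroup E] [InnerProductSpace ℂ E]
  [NormedAddCommGroup F] [InnerProductSpace ℂ F]
  [NormedAddCommGroup G] [InnerProductSpace ℂ G]

theorem ext_graph {S T : E →ₗ.[ℂ] F} (h : ∀ x y, (x, y) ∈ S.graph ↔ (x, y) ∈ T.graph) : S = T :=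
  LinearPMap.eq_of_eq_graph (Submodule.ext fun p => h p.1 p.2)

theorem mem_graph_mk {T : E →ₗ.[ℂ] F} {x : E} {y : F} :
    (x, y) ∈ T.graph ↔ ∃ h : x ∈ T.domain, T ⟨x, h⟩ = y := by
  simp

theorem mem_graph_comp {S : F →ₗ.[ℂ] G} {T : E →ₗ.[ℂ] F} {x : E} {z : G} :
    (x, z) ∈ (comp S T).graph ↔ ∃ y, (x, y) ∈ T.graph ∧ (y, z) ∈ S.graph := by
  constructor
  · rw [mem_graph_mk]
    rintro ⟨h, rfl⟩
    obtain ⟨y, hy, hyx⟩ := id h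
    have hyx : (y : E) = x := hyx
    subst hyx
    exact ⟨T y, T.mem_graph y, S.mem_graph ⟨T y, hy⟩⟩
  · rintro ⟨y, h₁, h₂⟩
    obtain ⟨hx, rfl⟩ := mem_graph_mk.1 h₁
    obtain ⟨hy, rfl⟩ := mem_graph_mk.1 h₂
    exact mem_graph_mk.2 ⟨⟨⟨x, hx⟩, hy, rfl⟩, rfl⟩

theorem mem_graph_total {f : E →ₗ[ℂ] F} {x : E} {y : F} : (x, y) ∈ (total f).graph ↔ f x = y := by
  rw [mem_graph_mk]
  exact ⟨fun ⟨_, h⟩ => h, fun h => ⟨trivial, h⟩⟩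

theorem mem_graph_toPMap {f : E →ₗ[ℂ] F} {p : Submodule ℂ E} {x : E} {y : F} :
    (x, y) ∈ (f.toPMap p).graph ↔ x ∈ p ∧ f x = y := by
  rw [mem_graph_mk]
  exact ⟨fun ⟨h, h'⟩ => ⟨h, h'⟩, fun ⟨h, h'⟩ => ⟨h, h'⟩⟩

theorem mem_graph_part {A : E →ₗ.[ℂ] E} {K : Submodule ℂ E} {x y : K} :
    (x, y) ∈ (part A K).graph ↔ ((x : E), (y : E)) ∈ A.graph := by
  constructor
  · rw [mem_graph_mk]
    rintro ⟨h, rfl⟩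
    obtain ⟨z, hz, hzx⟩ := id h
    have hzx : (z : E) = x := hzx
    exact mem_graph_mk.2 ⟨hzx ▸ z.2, rfl⟩
  · intro h
    obtain ⟨hx, hxy⟩ := mem_graph_mk.1 h
    refine mem_graph_mk.2 ⟨⟨⟨x, hx⟩, ?_, rfl⟩, Subtype.ext hxy⟩
    change A ⟨x, hx⟩ ∈ K
    exact hxy ▸ y.2

theorem mem_graph_codRestrict {T : E →ₗ.[ℂ] F} {K : Submodule ℂ F} {h : ∀ x, T x ∈ K}
    {x : E} {y : K} : (x, y) ∈ (T.codRestrict K h).graph ↔ (x, (y : F)) ∈ T.graph := by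
  rw [mem_graph_mk, mem_graph_mk]
  exact ⟨fun ⟨h, h'⟩ => ⟨h, congrArg Subtype.val h'⟩, fun ⟨h, h'⟩ => ⟨h, Subtype.ext h'⟩⟩

theorem mem_graph_add {S T : E →ₗ.[ℂ] F} {x : E} {z : F} :
    (x, z) ∈ (S + T).graph ↔ ∃ a b, (x, a) ∈ S.graph ∧ (x, b) ∈ T.graph ∧ a + b = z := by
  constructor
  · rw [mem_graph_mk]
    rintro ⟨h, rfl⟩
    exact ⟨_, _, S.mem_graph ⟨x, h.1⟩, T.mem_graph ⟨x, h.2⟩, rfl⟩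
  · rintro ⟨a, b, h₁, h₂, rfl⟩
    obtain ⟨hx, rfl⟩ := mem_graph_mk.1 h₁
    obtain ⟨hy, rfl⟩ := mem_graph_mk.1 h₂
    exact mem_graph_mk.2 ⟨⟨hx, hy⟩, rfl⟩

theorem ker_toFun_eq_bot {T : E →ₗ.[ℂ] F} :
    LinearMap.ker T.toFun = ⊥ ↔ ∀ x, (x, (0 : F)) ∈ T.graph → x = 0 := by
  rw [LinearMap.ker_eq_bot']
  constructor
  · intro h x hx
    obtain ⟨hx, h0⟩ := mem_graph_mk.1 hx
    exact congrArg Subtype.val (h ⟨x, hx⟩ h0)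
  · intro h x hx
    exact Subtype.ext (h x (mem_graph_mk.2 ⟨x.2, hx⟩))

theorem injective_iff_graph {T : E →ₗ.[ℂ] F} :
    Function.Injective T ↔ ∀ x, (x, (0 : F)) ∈ T.graph → x = 0 :=
  LinearMap.ker_eq_bot.symm.trans ker_toFun_eq_bot

theorem mem_graph_inverse {T : E →ₗ.[ℂ] F} (hT : ∀ x, (x, (0 : F)) ∈ T.graph → x = 0)
    {x : E} {y : F} : (y, x) ∈ T.inverse.graph ↔ (x, y) ∈ T.graph := by
  rw [LinearPMap.inverse_graph (ker_toFun_eq_bot.2 hT)]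
  constructor
  · rintro ⟨⟨a, b⟩, h, h'⟩
    obtain ⟨rfl, rfl⟩ := Prod.mk.inj h'
    exact h
  · intro h
    exact ⟨(x, y), h, rfl⟩

theorem mem_range_iff {T : E →ₗ.[ℂ] F} {y : F} : y ∈ range T ↔ ∃ x, (x, y) ∈ T.graph := by
  constructor
  · rintro ⟨x, rfl⟩
    exact ⟨x, T.mem_graph x⟩
  · rintro ⟨x, h⟩
    obtain ⟨hx, rfl⟩ := mem_graph_mk.1 h
    exact LinearMap.mem_range_self _ _

theorem mem_ker_iff {T : E →ₗ.[ℂ] F} {x : E} : x ∈ ker T ↔ (x, (0 : F)) ∈ T.graph := by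
  constructor
  · rintro ⟨y, hy, rfl⟩
    exact mem_graph_mk.2 ⟨y.2, hy⟩
  · intro h
    obtain ⟨hx, h⟩ := mem_graph_mk.1 h
    exact ⟨⟨x, hx⟩, h, rfl⟩

theorem mem_eigenspace_iff {A : E →ₗ.[ℂ] E} {z : ℂ} {x : E} :
    x ∈ eigenspace A z ↔ (x, z • x) ∈ A.graph := by
  constructor
  · rintro ⟨y, hy, rfl⟩
    exact mem_graph_mk.2 ⟨y.2, sub_eq_zero.1 hy⟩
  · intro h
    obtain ⟨hx, h⟩ := mem_graph_mk.1 h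
    exact ⟨⟨x, hx⟩, sub_eq_zero.2 h, rfl⟩

theorem isInvariant_iff_graph {A : E →ₗ.[ℂ] E} {K : Submodule ℂ E} :
    IsInvariant A K ↔ ∀ x y, (x, y) ∈ A.graph → x ∈ K → y ∈ K := by
  constructor
  · intro h x y hxy hx
    obtain ⟨hd, rfl⟩ := mem_graph_mk.1 hxy
    exact h ⟨x, hd⟩ hx
  · intro h x hx
    exact h x _ (A.mem_graph x) hx

theorem isStrictlyPositive_iff_graph {A : E →ₗ.[ℂ] E} :
    IsStrictlyPositive A ↔
      ∃ c : ℝ, 0 < c ∧ ∀ x y, (x, y) ∈ A.graph → c * ‖x‖ ^ 2 ≤ (inner ℂ x y).re := by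
  refine exists_congr fun c => and_congr_right fun _ => ?_
  constructor
  · intro h x y hxy
    obtain ⟨hd, rfl⟩ := mem_graph_mk.1 hxy
    exact h ⟨x, hd⟩
  · intro h x
    exact h x _ (A.mem_graph x)

theorem isResolventPoint_iff_graph {A : E →ₗ.[ℂ] E} {z : ℂ} :
    IsResolventPoint A z ↔ ∃ R : E →L[ℂ] E, (∀ y, (R y, y + z • R y) ∈ A.graph) ∧
      ∀ x y, (x, y) ∈ A.graph → R (y - z • x) = x := by
  refine exists_congr fun R => and_congr ?_ ?_
  · refine forall_congr' fun y => ?_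
    constructor
    · rintro ⟨x, hx, h⟩
      rw [← hx, ← sub_eq_iff_eq_add.1 h]
      exact A.mem_graph x
    · intro h
      obtain ⟨hx, h⟩ := mem_graph_mk.1 h
      exact ⟨⟨R y, hx⟩, rfl, sub_eq_iff_eq_add.2 h⟩
  · constructor
    · intro h x y hxy
      obtain ⟨hd, rfl⟩ := mem_graph_mk.1 hxy
      exact h ⟨x, hd⟩
    · intro h x
      exact h x _ (A.mem_graph x)

end Graph

/-! ### Adjoint pairs of closed operators. -/

section AdjointPair

variable {E F : Type*}
  [NormedAddCommGroup E] [InnerProductSpace ℂ E]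
  [NormedAddCommGroup F] [InnerProductSpace ℂ F]

/-- `S` and `S'` are adjoints of each other. -/
structure IsAdjointPair (S : E →ₗ.[ℂ] F) (S' : F →ₗ.[ℂ] E) : Prop where
  right_iff : ∀ y x, (y, x) ∈ S'.graph ↔
    ∀ a b, (a, b) ∈ S.graph → inner ℂ b y = inner ℂ a x
  left_iff : ∀ x y, (x, y) ∈ S.graph ↔
    ∀ b a, (b, a) ∈ S'.graph → inner ℂ a x = inner ℂ b y

theorem IsAdjointPair.symm {S : E →ₗ.[ℂ] F} {S' : F →ₗ.[ℂ] E} (h : IsAdjointPair S S') :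
    IsAdjointPair S' S :=
  ⟨h.left_iff, h.right_iff⟩

theorem IsAdjointPair.inner_eq {S : E →ₗ.[ℂ] F} {S' : F →ₗ.[ℂ] E} (h : IsAdjointPair S S')
    {a x : E} {b y : F} (hS : (a, b) ∈ S.graph) (hS' : (y, x) ∈ S'.graph) :
    inner ℂ b y = inner ℂ a x :=
  (h.right_iff y x).1 hS' a b hS

variable [CompleteSpace E]

theorem mem_graph_adjoint_iff {T : E →ₗ.[ℂ] F} (hT : Dense (T.domain : Set E)) {y : F} {x : E} :
    (y, x) ∈ T.adjoint.graph ↔ ∀ a b, (a, b) ∈ T.graph → inner ℂ b y = inner ℂ a x := by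
  rw [LinearPMap.adjoint_graph_eq_graph_adjoint hT]
  simp only [Submodule.mem_adjoint_iff, sub_eq_zero]

variable [CompleteSpace F]

/-- The product `E × F` carries the sup norm, so the projection onto the subspace is taken in the
Hilbert space `WithLp 2 (E × F)`. -/
theorem exists_orthogonal_decomposition (g : Submodule ℂ (E × F))
    (hg : IsClosed (g : Set (E × F))) (x : E) (y : F) :
    ∃ a b, (a, b) ∈ g ∧ ∀ a' b', (a', b') ∈ g →
      inner ℂ a' (x - a) + inner ℂ b' (y - b) = 0 := by
  let K : Submodule ℂ (WithLp 2 (E × F)) :=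
    g.comap (WithLp.linearEquiv 2 ℂ (E × F) : WithLp 2 (E × F) →ₗ[ℂ] E × F)
  have hK : IsClosed (K : Set (WithLp 2 (E × F))) :=
    hg.preimage (WithLp.prod_continuous_ofLp 2 E F)
  have : CompleteSpace K := hK.completeSpace_coe
  obtain ⟨p, hp, q, hq, hpq⟩ := K.exists_add_mem_mem_orthogonal (WithLp.toLp 2 (x, y))
  refine ⟨p.fst, p.snd, hp, fun a' b' h => ?_⟩
  have := (K.mem_orthogonal q).1 hq (WithLp.toLp 2 (a', b')) h
  have e : q = WithLp.toLp 2 (x, y) - p := by rw [hpq]; abel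
  rw [e] at this
  rw [WithLp.prod_inner_apply] at this
  exact this

/-- This is `T^{**} = T`. Subtract from `(x, y)` its projection `(a, b)` onto the graph of `T`. The
difference, rotated to `(y - b, -(x - a))`, lies in the graph of `T^*`. Pairing that element with
`(x, y)` and with `(a, b)` shows that the difference has norm zero. -/
theorem IsAdjointPair.of_isClosed {T : E →ₗ.[ℂ] F} (hT : Dense (T.domain : Set E))
    (hc : IsClosed (T.graph : Set (E × F))) : IsAdjointPair T T.adjoint := by
  refine ⟨fun y x => mem_graph_adjoint_iff hT, fun x y => ⟨fun h b a hba => ?_, fun h => ?_⟩⟩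
  · rw [← inner_conj_symm, ← inner_conj_symm b, (mem_graph_adjoint_iff hT).1 hba x y h]
  · obtain ⟨a, b, hab, horth⟩ := exists_orthogonal_decomposition T.graph hc x y
    have hmem : (y - b, -(x - a)) ∈ T.adjoint.graph := by
      rw [mem_graph_adjoint_iff hT]
      intro a' b' h'
      rw [inner_neg_right, eq_neg_iff_add_eq_zero, add_comm]
      exact horth a' b' h'
    have h₁ := h _ _ hmem
    have h₂ := (mem_graph_adjoint_iff hT).1 hmem a b hab
    have h₃ : inner ℂ (-(x - a)) a = inner ℂ (y - b) b := by
      rw [← inner_conj_symm, ← h₂, inner_conj_symm]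
    have h₄ : inner ℂ (x - a) (x - a) + inner ℂ (y - b) (y - b) = 0 := by
      rw [inner_sub_right (x - a), inner_sub_right (y - b), ← h₁, ← h₃, inner_neg_left,
        inner_neg_left]
      ring
    have h₅ : ‖x - a‖ ^ 2 + ‖y - b‖ ^ 2 = 0 := by
      have := congrArg RCLike.re h₄
      rwa [map_add, inner_self_eq_norm_sq, inner_self_eq_norm_sq, map_zero] at this
    have hx : x = a := by
      rw [← sub_eq_zero, ← norm_eq_zero]; nlinarith [sq_nonneg ‖x - a‖, sq_nonneg ‖y - b‖]
    have hy : y = b := by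
      rw [← sub_eq_zero, ← norm_eq_zero]; nlinarith [sq_nonneg ‖x - a‖, sq_nonneg ‖y - b‖]
    rw [hx, hy]
    exact hab

end AdjointPair

end UnboundedOp

namespace UnboundedOp

/-! ### The closed graph theorem for linear relations. -/

section Relation

theorem exists_linearMap_of_relation {V W : Type*} [AddCommGroup V] [Module ℂ V]
    [AddCommGroup W] [Module ℂ W] (R : Submodule ℂ (V × W))
    (hsv : ∀ w, ((0 : V), w) ∈ R → w = 0) (htot : ∀ v, ∃ w, (v, w) ∈ R) :
    ∃ f : V →ₗ[ℂ] W, ∀ v w, (v, w) ∈ R ↔ w = f v := by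
  have huniq : ∀ {v w w'}, (v, w) ∈ R → (v, w') ∈ R → w = w' := fun h h' =>
    sub_eq_zero.1 (hsv _ (by simpa using R.sub_mem h h'))
  choose f hf using htot
  refine ⟨⟨⟨f, fun x y => huniq (hf _) (R.add_mem (hf x) (hf y))⟩,
    fun c x => huniq (hf _) (R.smul_mem c (hf x))⟩, fun v w => ⟨fun h => huniq h (hf v), ?_⟩⟩
  rintro rfl
  exact hf v

theorem exists_continuousLinearMap_of_relation {V W : Type*}
    [NormedAddCommGroup V] [NormedSpace ℂ V] [CompleteSpace V]
    [NormedAddCommGroup W] [NormedSpace ℂ W] [CompleteSpace W] (R : Submodule ℂ (V × W))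
    (hc : IsClosed (R : Set (V × W)))
    (hsv : ∀ w, ((0 : V), w) ∈ R → w = 0) (htot : ∀ v, ∃ w, (v, w) ∈ R) :
    ∃ f : V →L[ℂ] W, ∀ v w, (v, w) ∈ R ↔ w = f v := by
  obtain ⟨f, hf⟩ := exists_linearMap_of_relation R hsv htot
  have : f.graph = R := by
    ext ⟨v, w⟩
    rw [hf, LinearMap.mem_graph_iff]
  exact ⟨⟨f, f.continuous_of_isClosed_graph (this ▸ hc)⟩, hf⟩

variable {E F : Type*}
  [NormedAddCommGroup E] [InnerProductSpace ℂ E]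
  [NormedAddCommGroup F] [InnerProductSpace ℂ F]

theorem range_eq_top_iff {T : E →ₗ.[ℂ] F} : range T = ⊤ ↔ ∀ y, ∃ x, (x, y) ∈ T.graph := by
  simp only [Submodule.eq_top_iff', mem_range_iff]

variable [CompleteSpace E] [CompleteSpace F]

theorem exists_bounded_inverse {T : E →ₗ.[ℂ] F} (hc : IsClosed (T.graph : Set (E × F)))
    (hinj : ∀ x, (x, (0 : F)) ∈ T.graph → x = 0) (hsurj : ∀ y, ∃ x, (x, y) ∈ T.graph) :
    ∃ K : F →L[ℂ] E, ∀ x y, (x, y) ∈ T.graph ↔ x = K y := by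
  obtain ⟨K, hK⟩ := exists_continuousLinearMap_of_relation
    (T.graph.comap (LinearEquiv.prodComm ℂ F E : F × E →ₗ[ℂ] E × F))
    (hc.preimage continuous_swap) hinj hsurj
  exact ⟨K, fun x y => hK y x⟩

end Relation

/-! ### Surjectivity for injective adjoint pairs. -/

namespace IsAdjointPair

variable {E F : Type*}
  [NormedAddCommGroup E] [InnerProductSpace ℂ E]
  [NormedAddCommGroup F] [InnerProductSpace ℂ F]
  {S : E →ₗ.[ℂ] F} {S' : F →ₗ.[ℂ] E}

theorem isClosed_graph (h : IsAdjointPair S S') : IsClosed (S.graph : Set (E × F)) := by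
  have : (S.graph : Set (E × F)) =
      ⋂ (b : F) (a : E) (_ : (b, a) ∈ S'.graph), {p | inner ℂ a p.1 = inner ℂ b p.2} := by
    ext p
    simpa using h.left_iff p.1 p.2
  rw [this]
  exact isClosed_iInter fun b => isClosed_iInter fun a => isClosed_iInter fun _ =>
    isClosed_eq (by fun_prop) (by fun_prop)

theorem re_inner_eq (h : IsAdjointPair S S') {v b : F} {a : E} (h₁ : (v, a) ∈ S'.graph)
    (h₂ : (a, b) ∈ S.graph) : (inner ℂ b v : ℂ).re = ‖a‖ ^ 2 := by
  rw [h.inner_eq h₂ h₁]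
  exact inner_self_eq_norm_sq (𝕜 := ℂ) a

theorem sq_norm_add (h : IsAdjointPair S S') {v b : F} {a : E} (h₁ : (v, a) ∈ S'.graph)
    (h₂ : (a, b) ∈ S.graph) : ‖v + b‖ ^ 2 = ‖v‖ ^ 2 + 2 * ‖a‖ ^ 2 + ‖b‖ ^ 2 := by
  rw [add_comm, norm_add_sq (𝕜 := ℂ), ← h.re_inner_eq h₁ h₂]
  simp only [RCLike.re_to_complex]
  ring

variable [CompleteSpace E] [CompleteSpace F]

/-- Von Neumann's argument for the surjectivity of `1 + S S'`: project `(w, 0)` onto the graph of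
`S'`. Orthogonality of the remainder `(w - v, -a)` says exactly that `S a = w - v`. -/
theorem exists_add_eq (h : IsAdjointPair S S') (w : F) :
    ∃ v a b, (v, a) ∈ S'.graph ∧ (a, b) ∈ S.graph ∧ v + b = w := by
  obtain ⟨v, a, hva, horth⟩ := exists_orthogonal_decomposition S'.graph h.symm.isClosed_graph w 0
  refine ⟨v, a, w - v, hva, ?_, by abel⟩
  rw [h.left_iff]
  intro b' a' h'
  have := horth b' a' h'
  rw [zero_sub, inner_neg_right, ← sub_eq_add_neg, sub_eq_zero] at this
  exact this.symm

/-- Write a vector orthogonal to the range as `v + b` with `a = S' v` and `b = S a`. Pairing it with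
`b` gives `‖a‖² + ‖b‖² = 0`, so `S' v = 0` and `v = 0`. -/
theorem range_comp_dense (h : IsAdjointPair S S')
    (hinj : ∀ y, (y, (0 : E)) ∈ S'.graph → y = 0) :
    (range (comp S S')).topologicalClosure = ⊤ := by
  rw [Submodule.topologicalClosure_eq_top_iff, Submodule.eq_bot_iff]
  intro y hy
  obtain ⟨v, a, b, h₁, h₂, rfl⟩ := h.exists_add_eq y
  have h₀ : inner ℂ b (v + b) = 0 :=
    (Submodule.mem_orthogonal _ _).1 hy b (mem_range_iff.2 ⟨v, mem_graph_comp.2 ⟨a, h₁, h₂⟩⟩)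
  have h₃ : ‖a‖ ^ 2 + ‖b‖ ^ 2 = 0 := by
    have := congrArg Complex.re h₀
    rw [inner_add_right, Complex.add_re, h.re_inner_eq h₁ h₂, Complex.zero_re] at this
    rw [← this]
    congr 1
    exact (inner_self_eq_norm_sq (𝕜 := ℂ) b).symm
  have ha : a = 0 := by
    rw [← norm_eq_zero]; nlinarith [sq_nonneg ‖a‖, sq_nonneg ‖b‖]
  have hb : b = 0 := by
    rw [← norm_eq_zero]; nlinarith [sq_nonneg ‖a‖, sq_nonneg ‖b‖]
  subst ha hb
  rw [hinj v h₁, add_zero]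

/-- The operator `B = S S' (1 + S S')⁻¹` is a contraction with the same range as `S S'`. The
hypothesis bounds `B` from below, so this dense range is closed. -/
theorem surjective_comp_of_bounded_below (h : IsAdjointPair S S')
    (hinj : ∀ y, (y, (0 : E)) ∈ S'.graph → y = 0) {C : ℝ}
    (hC : ∀ v a b, (v, a) ∈ S'.graph → (a, b) ∈ S.graph → ‖v + b‖ ≤ C * ‖b‖) (y : F) :
    ∃ v, (v, y) ∈ (comp S S').graph := by
  -- The graph of `B`: with `w = v + b` and `b = S S' v`, the pair `(w, b)` satisfies `w - b = v`.
  let R : Submodule ℂ (F × F) := (comp S S').graph.comap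
    ((LinearMap.fst ℂ F F - LinearMap.snd ℂ F F).prod (LinearMap.snd ℂ F F))
  have hR : ∀ w b, (w, b) ∈ R ↔ (w - b, b) ∈ (comp S S').graph := fun _ _ => Iff.rfl
  obtain ⟨B, hB⟩ := exists_linearMap_of_relation R
    (by
      intro b hb
      rw [hR, mem_graph_comp] at hb
      obtain ⟨a, h₁, h₂⟩ := hb
      have := h.sq_norm_add h₁ h₂
      rw [zero_sub, neg_add_cancel, norm_zero, norm_neg] at this
      rw [← norm_eq_zero]
      nlinarith [sq_nonneg ‖a‖, sq_nonneg ‖b‖])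
    (by
      intro w
      obtain ⟨v, a, b, h₁, h₂, rfl⟩ := h.exists_add_eq w
      exact ⟨b, (hR _ _).2 (mem_graph_comp.2 ⟨a, by rwa [add_sub_cancel_right], h₂⟩)⟩)
  have hBg : ∀ w, (w - B w, B w) ∈ (comp S S').graph := fun w => (hR _ _).1 ((hB _ _).2 rfl)
  have hle : ∀ w, ‖B w‖ ≤ ‖w‖ := by
    intro w
    obtain ⟨a, h₁, h₂⟩ := mem_graph_comp.1 (hBg w)
    have := h.sq_norm_add h₁ h₂
    rw [sub_add_cancel] at this
    exact le_of_sq_le_sq (by nlinarith [sq_nonneg ‖a‖, sq_nonneg ‖w - B w‖]) (norm_nonneg _)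
  have hge : ∀ w, ‖w‖ ≤ C * ‖B w‖ := by
    intro w
    obtain ⟨a, h₁, h₂⟩ := mem_graph_comp.1 (hBg w)
    have := hC _ _ _ h₁ h₂
    rwa [sub_add_cancel] at this
  let B' : F →L[ℂ] F := B.mkContinuous 1 fun w => by rw [one_mul]; exact hle w
  have hanti : AntilipschitzWith C.toNNReal B' := by
    refine B'.antilipschitz_of_bound fun w => (hge w).trans ?_
    exact mul_le_mul_of_nonneg_right (Real.le_coe_toNNReal C) (norm_nonneg _)
  have hclosed : IsClosed (Set.range B') := hanti.isClosed_range B'.uniformContinuous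
  have hrange : (range (comp S S') : Set F) = Set.range B' := by
    ext b
    rw [SetLike.mem_coe, mem_range_iff]
    constructor
    · rintro ⟨v, hv⟩
      refine ⟨v + b, ((hB _ _).1 ((hR _ _).2 ?_)).symm⟩
      rwa [add_sub_cancel_right]
    · rintro ⟨w, rfl⟩
      exact ⟨_, hBg w⟩
  have htop : range (comp S S') = ⊤ := by
    rw [← h.range_comp_dense hinj]
    exact (IsClosed.submodule_topologicalClosure_eq (hrange ▸ hclosed)).symm
  rw [← mem_range_iff, htop]
  trivial

theorem surjective_comp_of_lower_bound (h : IsAdjointPair S S')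
    (hinj : ∀ y, (y, (0 : E)) ∈ S'.graph → y = 0) {c : ℝ} (hc : 0 < c)
    (hb : ∀ v a b, (v, a) ∈ S'.graph → (a, b) ∈ S.graph → c * ‖v‖ ^ 2 ≤ ‖a‖ ^ 2) (y : F) :
    ∃ v, (v, y) ∈ (comp S S').graph := by
  refine h.surjective_comp_of_bounded_below hinj (C := 1 / c + 1) (fun v a b h₁ h₂ => ?_) y
  have h₃ : ‖v‖ ≤ 1 / c * ‖b‖ := by
    have h₄ : c * ‖v‖ ^ 2 ≤ ‖b‖ * ‖v‖ := by
      refine (hb v a b h₁ h₂).trans ?_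
      rw [← h.re_inner_eq h₁ h₂]
      exact re_inner_le_norm (𝕜 := ℂ) b v
    rw [div_mul_eq_mul_div, one_mul, le_div_iff₀ hc]
    rcases (norm_nonneg v).eq_or_lt with h₀ | h₀
    · rw [← h₀, zero_mul]; exact norm_nonneg b
    · nlinarith
  calc ‖v + b‖ ≤ ‖v‖ + ‖b‖ := norm_add_le _ _
    _ ≤ (1 / c + 1) * ‖b‖ := by linarith

theorem exists_lower_bound_of_surjective (h : IsAdjointPair S S')
    (hinj : ∀ y, (y, (0 : E)) ∈ S'.graph → y = 0) (hsurj : ∀ x, ∃ y, (y, x) ∈ S'.graph) :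
    ∃ c : ℝ, 0 < c ∧ ∀ v a, (v, a) ∈ S'.graph → c * ‖v‖ ^ 2 ≤ ‖a‖ ^ 2 := by
  obtain ⟨K, hK⟩ := exists_bounded_inverse h.symm.isClosed_graph hinj hsurj
  have hpos : 0 < ‖K‖ + 1 := by positivity
  -- Adding 1 keeps the denominator positive when `K = 0`.
  refine ⟨1 / (‖K‖ + 1) ^ 2, by positivity, fun v a hva => ?_⟩
  rw [div_mul_eq_mul_div, one_mul, div_le_iff₀ (by positivity), ← mul_pow, (hK v a).1 hva, mul_comm]
  gcongr
  exact (K.le_opNorm a).trans (mul_le_mul_of_nonneg_right (by linarith) (norm_nonneg _))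

/-- If `S a = S S' v`, injectivity of `S` gives `S' v = a`. So every `a` in the domain of `S` has a
preimage `v` under `S'`, and by the closed graph theorem `v` depends boundedly on `(a, b)` in the
graph norm of `S`. This weak estimate suffices for a lower bound on `B`. -/
theorem surjective_comp_of_range_le (h : IsAdjointPair S S')
    (hinj : ∀ x, (x, (0 : F)) ∈ S.graph → x = 0) (hinj' : ∀ y, (y, (0 : E)) ∈ S'.graph → y = 0)
    (hr : ∀ a b, (a, b) ∈ S.graph → ∃ v, (v, b) ∈ (comp S S').graph) (y : F) :
    ∃ v, (v, y) ∈ (comp S S').graph := by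
  have : CompleteSpace S.graph := h.isClosed_graph.completeSpace_coe
  let L : S.graph × F →ₗ[ℂ] F × E :=
    (LinearMap.snd ℂ S.graph F).prod
      (LinearMap.fst ℂ E F ∘ₗ S.graph.subtype ∘ₗ LinearMap.fst ℂ S.graph F)
  have hL : Continuous L := by
    change Continuous fun p : S.graph × F => (p.2, (p.1 : E × F).1)
    fun_prop
  obtain ⟨Φ, hΦ⟩ := exists_continuousLinearMap_of_relation (S'.graph.comap L)
    (h.symm.isClosed_graph.preimage hL) (fun w hw => hinj' w hw) (by
      rintro ⟨⟨a, b⟩, hab⟩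
      obtain ⟨v, hv⟩ := hr a b hab
      obtain ⟨c, h₁, h₂⟩ := mem_graph_comp.1 hv
      have : a - c = 0 := hinj _ (by simpa using S.graph.sub_mem hab h₂)
      rw [← sub_eq_zero.1 this] at h₁
      exact ⟨v, h₁⟩)
  have hbound : ∀ v a b, (v, a) ∈ S'.graph → (a, b) ∈ S.graph →
      ‖v‖ ^ 2 ≤ ‖Φ‖ ^ 2 * (‖a‖ ^ 2 + ‖b‖ ^ 2) := by
    intro v a b h₁ h₂
    have h₃ : v = Φ ⟨(a, b), h₂⟩ := (hΦ ⟨(a, b), h₂⟩ v).1 h₁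
    have h₄ : ‖v‖ ≤ ‖Φ‖ * max ‖a‖ ‖b‖ := h₃ ▸ Φ.le_opNorm ⟨(a, b), h₂⟩
    have h₅ : max ‖a‖ ‖b‖ ^ 2 ≤ ‖a‖ ^ 2 + ‖b‖ ^ 2 := by
      rcases max_choice ‖a‖ ‖b‖ with h | h <;> rw [h] <;> nlinarith [sq_nonneg ‖a‖, sq_nonneg ‖b‖]
    calc ‖v‖ ^ 2 ≤ (‖Φ‖ * max ‖a‖ ‖b‖) ^ 2 := by gcongr
      _ = ‖Φ‖ ^ 2 * max ‖a‖ ‖b‖ ^ 2 := mul_pow _ _ _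
      _ ≤ _ := by gcongr
  -- In `‖v + b‖² = ‖v‖² + 2‖a‖² + ‖b‖²` the right side is at most `(‖Φ‖² + 2)(‖a‖² + ‖b‖²)`. The
  -- last factor equals `Re ⟪b, v + b⟫ ≤ ‖b‖ ‖v + b‖`, and one factor `‖v + b‖` cancels.
  refine h.surjective_comp_of_bounded_below hinj' (C := ‖Φ‖ ^ 2 + 2) (fun v a b h₁ h₂ => ?_) y
  have h₃ := hbound v a b h₁ h₂
  have h₄ := h.sq_norm_add h₁ h₂
  have h₅ : ‖a‖ ^ 2 + ‖b‖ ^ 2 ≤ ‖b‖ * ‖v + b‖ := by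
    have : (inner ℂ b (v + b) : ℂ).re = ‖a‖ ^ 2 + ‖b‖ ^ 2 := by
      rw [inner_add_right, Complex.add_re, h.re_inner_eq h₁ h₂]
      congr 1
      exact inner_self_eq_norm_sq (𝕜 := ℂ) b
    rw [← this]
    exact re_inner_le_norm (𝕜 := ℂ) b (v + b)
  have h₆ : ‖v + b‖ ^ 2 ≤ (‖Φ‖ ^ 2 + 2) * (‖b‖ * ‖v + b‖) := by
    have : ‖v + b‖ ^ 2 ≤ (‖Φ‖ ^ 2 + 2) * (‖a‖ ^ 2 + ‖b‖ ^ 2) := by nlinarith [sq_nonneg ‖b‖]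
    exact this.trans (by gcongr)
  rcases (norm_nonneg (v + b)).eq_or_lt with h₀ | h₀
  · rw [← h₀]; positivity
  · nlinarith

theorem tfae_surjective (h : IsAdjointPair S S')
    (hinj : ∀ x, (x, (0 : F)) ∈ S.graph → x = 0) (hinj' : ∀ y, (y, (0 : E)) ∈ S'.graph → y = 0) :
    List.TFAE [
      range (comp S' S) = ⊤,
      range S = ⊤,
      range S' = ⊤,
      IsStrictlyPositive (comp S S'),
      range S ≤ range (comp S S')] := by
  tfae_have 1 → 3 := by
    intro h'
    rw [eq_top_iff, ← h']
    intro x hx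
    obtain ⟨a, ha⟩ := mem_range_iff.1 hx
    obtain ⟨b, -, hb⟩ := mem_graph_comp.1 ha
    exact mem_range_iff.2 ⟨b, hb⟩
  tfae_have 3 → 4 := by
    intro h'
    obtain ⟨c, hc, hb⟩ := h.exists_lower_bound_of_surjective hinj' (range_eq_top_iff.1 h')
    refine isStrictlyPositive_iff_graph.2 ⟨c, hc, fun v w hvw => ?_⟩
    obtain ⟨a, h₁, h₂⟩ := mem_graph_comp.1 hvw
    refine (hb v a h₁).trans_eq ?_
    rw [← h.re_inner_eq h₁ h₂, ← inner_conj_symm, Complex.conj_re]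
  have h45 : IsStrictlyPositive (comp S S') → range (comp S S') = ⊤ := by
    intro h'
    obtain ⟨c, hc, hb⟩ := isStrictlyPositive_iff_graph.1 h'
    refine range_eq_top_iff.2 fun y =>
      (h.surjective_comp_of_lower_bound hinj' hc (fun v a b h₁ h₂ => ?_) y)
    refine (hb v b (mem_graph_comp.2 ⟨a, h₁, h₂⟩)).trans_eq ?_
    rw [← h.re_inner_eq h₁ h₂, ← inner_conj_symm, Complex.conj_re]
  tfae_have 4 → 5 := fun h' => h45 h' ▸ le_top
  tfae_have 5 → 2 := by
    intro h'
    refine range_eq_top_iff.2 fun y => ?_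
    obtain ⟨v, hv⟩ := h.surjective_comp_of_range_le hinj hinj'
      (fun a b hab => mem_range_iff.1 (h' (mem_range_iff.2 ⟨a, hab⟩))) y
    obtain ⟨a, -, ha⟩ := mem_graph_comp.1 hv
    exact ⟨a, ha⟩
  tfae_have 2 → 1 := by
    intro h'
    obtain ⟨c, hc, hb⟩ := h.symm.exists_lower_bound_of_surjective hinj (range_eq_top_iff.1 h')
    exact range_eq_top_iff.2 fun x =>
      (h.symm.surjective_comp_of_lower_bound hinj hc (fun v a b h₁ _ => hb v a h₁) x)
  tfae_finish

end IsAdjointPair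

end UnboundedOp

namespace UnboundedOp

/-! ### Polar decomposition and square roots of operators with bounded inverse. -/

section Polar

open ContinuousLinearMap

variable {E F : Type*}
  [NormedAddCommGroup E] [InnerProductSpace ℂ E] [CompleteSpace E]
  [NormedAddCommGroup F] [InnerProductSpace ℂ F] [CompleteSpace F]

theorem denseRange_of_injective_adjoint (T : E →L[ℂ] F) (hT : Function.Injective (adjoint T)) :
    DenseRange T := by
  have : Dense (T.range : Set F) := by
    rw [Submodule.dense_iff_topologicalClosure_eq_top, Submodule.topologicalClosure_eq_top_iff,
      T.orthogonal_range, LinearMap.ker_eq_bot]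
    exact hT
  exact this

/-- With `H = (K K^*)^{1/2}` one has `‖K^* x‖ = ‖H x‖`, so `H x ↦ K^* x` extends isometrically from
the dense range of `H`. The extension is onto because injectivity of `K` makes the range of `K^*`
dense. -/
theorem exists_polar_decomposition (K : F →L[ℂ] E) (hK : Function.Injective K)
    (hK' : Function.Injective (adjoint K)) :
    ∃ (H : E →L[ℂ] E) (U : E ≃ₗᵢ[ℂ] F), 0 ≤ H ∧ H * H = K ∘L adjoint K ∧
      (∀ x, K (U x) = H x) ∧ ∀ x, adjoint K x = U (H x) := by
  have hC : 0 ≤ K ∘L adjoint K := by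
    rw [nonneg_iff_isPositive]
    exact isPositive_self_comp_adjoint K
  set C := K ∘L adjoint K
  set H := CFC.sqrt C
  have hH : 0 ≤ H := CFC.sqrt_nonneg C
  have hHH : H * H = C := CFC.sqrt_mul_sqrt_self C hC
  have hsa : adjoint H = H := ((nonneg_iff_isPositive H).1 hH).isSelfAdjoint
  have hnorm : ∀ x, ‖adjoint K x‖ = ‖H x‖ := by
    intro x
    have h₁ : (inner ℂ (adjoint K x) (adjoint K x) : ℂ) = inner ℂ (H x) (H x) := by
      rw [adjoint_inner_left, ← adjoint_inner_right H, hsa]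
      change inner ℂ x (C x) = inner ℂ x ((H * H) x)
      rw [hHH]
    rw [inner_self_eq_norm_sq_to_K, inner_self_eq_norm_sq_to_K] at h₁
    exact (sq_eq_sq₀ (norm_nonneg _) (norm_nonneg _)).1 (by exact_mod_cast h₁)
  have hHinj : Function.Injective H := by
    rw [injective_iff_map_eq_zero]
    intro x hx
    have := hnorm x
    rw [hx, norm_zero, norm_eq_zero] at this
    exact (injective_iff_map_eq_zero _).1 hK' x this
  have hHd : DenseRange H := denseRange_of_injective_adjoint H (hsa.symm ▸ hHinj)
  have hKd : DenseRange (adjoint K) := denseRange_of_injective_adjoint _ (by rwa [adjoint_adjoint])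
  have hext : ∃ c, ∀ x, ‖(adjoint K : E →ₗ[ℂ] F) x‖ ≤ c * ‖(H : E →ₗ[ℂ] E) x‖ :=
    ⟨1, fun x => by rw [one_mul]; exact (hnorm x).le⟩
  set V : E →L[ℂ] F := (adjoint K : E →ₗ[ℂ] F).extendOfNorm (H : E →ₗ[ℂ] E)
  have hV : ∀ x, V (H x) = adjoint K x := LinearMap.extendOfNorm_eq hHd hext
  have hVn : ∀ x, ‖V x‖ = ‖x‖ := by
    intro x
    refine hHd.induction_on (p := fun x => ‖V x‖ = ‖x‖) x
      (isClosed_eq (by fun_prop) (by fun_prop)) fun a => ?_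
    rw [hV, hnorm]
  let V' : E →ₗᵢ[ℂ] F := ⟨V, hVn⟩
  have hVs : Function.Surjective V' := by
    have hcl : IsClosed (Set.range V') := V'.isometry.isClosedEmbedding.isClosed_range
    have hd : DenseRange V' := hKd.mono (by
      rintro _ ⟨x, rfl⟩
      exact ⟨H x, hV x⟩)
    intro y
    have : closure (Set.range V') = Set.univ := hd.closure_range
    rw [hcl.closure_eq] at this
    change y ∈ Set.range V'
    rw [this]
    trivial
  let U : E ≃ₗᵢ[ℂ] F := LinearIsometryEquiv.ofSurjective V' hVs
  have hU : ∀ x, adjoint K x = U (H x) := fun x => (hV x).symm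
  refine ⟨H, U, hH, hHH, fun x => ?_, hU⟩
  -- `K U = H` follows from `K^* = U H` by taking adjoints, as `H` is self-adjoint.
  refine ext_inner_right ℂ fun z => ?_
  rw [← adjoint_inner_right, hU, U.inner_map_map, ← adjoint_inner_right H, hsa]

theorem IsAdjointPair.of_isSelfAdjoint {Q : E →ₗ.[ℂ] E} (hQ : IsSelfAdjoint Q) :
    IsAdjointPair Q Q := by
  have := IsAdjointPair.of_isClosed hQ.dense_domain hQ.isClosed
  rwa [LinearPMap.isSelfAdjoint_def.1 hQ] at this

/-- Reduces uniqueness of the unbounded square root to that of the bounded positive square root of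
`A⁻¹ = W²`. -/
theorem IsSqrt.exists_bounded_inverse {A Q : E →ₗ.[ℂ] E} (hQ : IsSqrt A Q)
    (hinj : ∀ x, (x, (0 : E)) ∈ A.graph → x = 0) (hsurj : ∀ y, ∃ x, (x, y) ∈ A.graph) :
    ∃ W : E →L[ℂ] E, 0 ≤ W ∧ (∀ x y, (x, y) ∈ Q.graph ↔ x = W y) ∧
      ∀ x y, (x, y) ∈ A.graph ↔ x = (W * W) y := by
  obtain ⟨hsa, hnn, hA⟩ := hQ
  have hp := IsAdjointPair.of_isSelfAdjoint hsa
  obtain ⟨W, hW⟩ := UnboundedOp.exists_bounded_inverse hp.isClosed_graph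
    (fun x hx => hinj x (by
      rw [← hA, mem_graph_comp]
      exact ⟨0, hx, Q.graph.zero_mem⟩))
    (fun y => by
      obtain ⟨x, hx⟩ := hsurj y
      rw [← hA, mem_graph_comp] at hx
      obtain ⟨z, -, hz⟩ := hx
      exact ⟨z, hz⟩)
  refine ⟨W, ?_, hW, fun x y => ?_⟩
  · rw [nonneg_iff_isPositive]
    refine ⟨fun x y => ?_, fun y => ?_⟩
    · exact (hp.inner_eq ((hW _ _).2 rfl) ((hW _ _).2 rfl)).symm
    · obtain ⟨hd, h⟩ := mem_graph_mk.1 ((hW (W y) y).2 rfl)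
      have := hnn ⟨W y, hd⟩
      rwa [h] at this
  · rw [← hA, mem_graph_comp]
    constructor
    · rintro ⟨z, h₁, h₂⟩
      rw [(hW x z).1 h₁, (hW z y).1 h₂]
      rfl
    · rintro rfl
      exact ⟨W y, (hW _ _).2 rfl, (hW _ _).2 rfl⟩

theorem IsSqrt.unique {A Q Q' : E →ₗ.[ℂ] E} (hQ : IsSqrt A Q) (hQ' : IsSqrt A Q')
    (hinj : ∀ x, (x, (0 : E)) ∈ A.graph → x = 0) (hsurj : ∀ y, ∃ x, (x, y) ∈ A.graph) :
    Q' = Q := by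
  obtain ⟨W, h0, hW, hA⟩ := hQ.exists_bounded_inverse hinj hsurj
  obtain ⟨W', h0', hW', hA'⟩ := hQ'.exists_bounded_inverse hinj hsurj
  have : W * W = W' * W' := by
    ext y
    rw [← hA', hA]
  have hWW : W = W' := by
    rw [← CFC.sqrt_mul_self W h0, this, CFC.sqrt_mul_self W' h0']
  refine ext_graph fun x y => ?_
  rw [hW', hW, hWW]

theorem isSqrt_inverse_total {A : E →ₗ.[ℂ] E} {H : E →L[ℂ] E} (h0 : 0 ≤ H)
    (hinj : Function.Injective H) (hA : ∀ x y, (x, y) ∈ A.graph ↔ x = (H * H) y) :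
    IsSqrt A (total (H : E →ₗ[ℂ] E)).inverse := by
  have hg : ∀ x y, (x, y) ∈ (total (H : E →ₗ[ℂ] E)).inverse.graph ↔ H y = x := by
    intro x y
    rw [mem_graph_inverse, mem_graph_total]
    · rfl
    · intro x hx
      rw [mem_graph_total] at hx
      exact (injective_iff_map_eq_zero _).1 hinj x hx
  have hpos := (nonneg_iff_isPositive H).1 h0
  have hsym : ∀ x y, inner ℂ (H x) y = inner ℂ x (H y) := hpos.isSymmetric
  have hdense : Dense ((total (H : E →ₗ[ℂ] E)).inverse.domain : Set E) := by
    rw [Submodule.dense_iff_topologicalClosure_eq_top, Submodule.topologicalClosure_eq_top_iff,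
      Submodule.eq_bot_iff]
    intro y hy
    refine (injective_iff_map_eq_zero _).1 hinj y (inner_self_eq_zero (𝕜 := ℂ).1 ?_)
    rw [← hsym]
    exact (Submodule.mem_orthogonal _ _).1 hy _ (mem_graph_mk.1 ((hg _ _).2 rfl)).1
  refine ⟨?_, fun x => ?_, ?_⟩
  · rw [LinearPMap.isSelfAdjoint_def]
    refine ext_graph fun y x => ?_
    rw [mem_graph_adjoint_iff hdense, hg]
    constructor
    · intro h
      refine ext_inner_left ℂ fun b => ?_
      rw [h (H b) b ((hg _ _).2 rfl), hsym]
    · rintro rfl a b hab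
      rw [← (hg _ _).1 hab, hsym]
  · have := (hg _ _).1 (LinearPMap.mem_graph _ x)
    have h' := hpos.2 ((total (H : E →ₗ[ℂ] E)).inverse x)
    rw [reApplyInnerSelf_apply, this] at h'
    exact h'
  · refine ext_graph fun x y => ?_
    rw [mem_graph_comp, hA]
    constructor
    · rintro ⟨z, h₁, h₂⟩
      rw [← (hg _ _).1 h₁, ← (hg _ _).1 h₂]
      rfl
    · rintro rfl
      exact ⟨H y, (hg _ _).2 rfl, (hg _ _).2 rfl⟩

end Polar

/-! ### Unitary invariance of the spectrum and the essential spectrum. -/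

section UnitaryEquivalence

variable {E F : Type*}
  [NormedAddCommGroup E] [InnerProductSpace ℂ E]
  [NormedAddCommGroup F] [InnerProductSpace ℂ F]

theorem isResolventPoint_of_unitary_equiv {A : E →ₗ.[ℂ] E} {B : F →ₗ.[ℂ] F} (U : E ≃ₗᵢ[ℂ] F)
    (hU : ∀ x y, (x, y) ∈ A.graph ↔ (U x, U y) ∈ B.graph) {z : ℂ} (h : IsResolventPoint A z) :
    IsResolventPoint B z := by
  rw [isResolventPoint_iff_graph] at h ⊢
  obtain ⟨R, h₁, h₂⟩ := h
  refine ⟨(U.toContinuousLinearEquiv : E →L[ℂ] F) ∘L R ∘L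
    (U.symm.toContinuousLinearEquiv : F →L[ℂ] E), fun y => ?_, fun x y hxy => ?_⟩
  · have := (hU _ _).1 (h₁ (U.symm y))
    rw [map_add, map_smul, U.apply_symm_apply] at this
    exact this
  · have := h₂ (U.symm x) (U.symm y) ((hU _ _).2 (by simpa using hxy))
    change U (R (U.symm (y - z • x))) = x
    rw [map_sub, map_smul, this, U.apply_symm_apply]

theorem spectrum_eq_of_unitary_equiv {A : E →ₗ.[ℂ] E} {B : F →ₗ.[ℂ] F} (U : E ≃ₗᵢ[ℂ] F)
    (hU : ∀ x y, (x, y) ∈ A.graph ↔ (U x, U y) ∈ B.graph) : spectrum A = spectrum B := by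
  ext z
  refine not_congr ⟨isResolventPoint_of_unitary_equiv U hU,
    isResolventPoint_of_unitary_equiv U.symm fun x y => ?_⟩
  rw [hU, U.apply_symm_apply, U.apply_symm_apply]

theorem essentialSpectrum_eq_of_unitary_equiv {A : E →ₗ.[ℂ] E} {B : F →ₗ.[ℂ] F} (U : E ≃ₗᵢ[ℂ] F)
    (hU : ∀ x y, (x, y) ∈ A.graph ↔ (U x, U y) ∈ B.graph) :
    essentialSpectrum A = essentialSpectrum B := by
  have hs := spectrum_eq_of_unitary_equiv U hU
  have he : ∀ z, (eigenspace A z).map (U.toLinearEquiv : E →ₗ[ℂ] F) = eigenspace B z := by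
    intro z
    ext y
    constructor
    · rintro ⟨x, hx, rfl⟩
      have := (hU _ _).1 (mem_eigenspace_iff.1 hx)
      rw [map_smul] at this
      exact mem_eigenspace_iff.2 this
    · intro hy
      refine ⟨U.symm y, mem_eigenspace_iff.2 ((hU _ _).2 ?_), U.apply_symm_apply y⟩
      rw [map_smul, U.apply_symm_apply]
      exact mem_eigenspace_iff.1 hy
  have hd : discreteSpectrum A = discreteSpectrum B := by
    ext z
    have e : eigenspace A z ≃ₗ[ℂ] eigenspace B z :=
      (U.toLinearEquiv.submoduleMap (eigenspace A z)).trans (LinearEquiv.ofEq _ _ (he z))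
    have h₁ : eigenspace A z ≠ ⊥ ↔ eigenspace B z ≠ ⊥ := by
      rw [← he z, Ne, Ne, Submodule.map_eq_bot_iff]
    have h₂ : FiniteDimensional ℂ (eigenspace A z) ↔ FiniteDimensional ℂ (eigenspace B z) :=
      ⟨fun _ => e.finiteDimensional, fun _ => e.symm.finiteDimensional⟩
    simp only [discreteSpectrum, Set.mem_ofPred_eq, hs, h₁, h₂]
  rw [essentialSpectrum, essentialSpectrum, hs, hd]

end UnitaryEquivalence

end UnboundedOp

/-! ### Density of the domain of `d`, and `d ∘ d = 0`. -/

namespace DeRham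

variable {n k : ℕ}

theorem contDiff_coord {u : Space n → Form n k} (hu : ContDiff ℝ (⊤ : ℕ∞) u)
    (J : Fin k ↪o Fin n) : ContDiff ℝ (⊤ : ℕ∞) fun x => u x J :=
  ((EuclideanSpace.proj (𝕜 := ℂ) J).restrictScalars ℝ).contDiff.comp hu

/-- The exterior differential of a smooth form. -/
noncomputable def smoothD (u : Space n → Form n k) (x : Space n) : Form n (k + 1) :=
  WithLp.toLp 2 fun K => ∑ i : Fin (k + 1), (-1 : ℂ) ^ (i : ℕ) *
    fderiv ℝ (fun y => u y ((Fin.succAboveOrderEmb i).trans K)) x (EuclideanSpace.single (K i) 1)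

theorem continuous_smoothD {u : Space n → Form n k} (hu : ContDiff ℝ (⊤ : ℕ∞) u) :
    Continuous (smoothD u) := by
  refine (PiLp.continuous_toLp 2 _).comp (continuous_pi fun K => ?_)
  refine continuous_finsetSum _ fun i _ => continuous_const.mul ?_
  exact ((contDiff_coord hu _).continuous_fderiv (by simp)).clm_apply continuous_const

theorem hasCompactSupport_smoothD {u : Space n → Form n k} (hc : HasCompactSupport u) :
    HasCompactSupport (smoothD u) := by
  refine HasCompactSupport.of_support_subset_isCompact hc fun x hx => ?_
  by_contra hxu
  refine hx ?_
  ext K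
  change (∑ _ : Fin (k + 1), _ : ℂ) = 0
  refine Finset.sum_eq_zero fun i _ => ?_
  have : fderiv ℝ (fun y => u y ((Fin.succAboveOrderEmb i).trans K)) x = 0 := by
    refine fderiv_of_notMem_tsupport ℝ fun h => hxu ?_
    exact closure_mono (Function.support_comp_subset (g := fun v : Form n k => v _) rfl u) h
  simp [this]

theorem isWeakD_smoothD {u : Space n → Form n k} (hu : ContDiff ℝ (⊤ : ℕ∞) u) :
    IsWeakD u (smoothD u) := by
  intro φ hφ hφc K
  have hint : ∀ (i : Fin (k + 1)), Integrable (fun x =>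
      fderiv ℝ (fun y => u y ((Fin.succAboveOrderEmb i).trans K)) x
        (EuclideanSpace.single (K i) 1) * φ x) volume := fun i =>
    (((((contDiff_coord hu _).continuous_fderiv (by simp)).clm_apply continuous_const).mul
      hφ.continuous).integrable_of_hasCompactSupport hφc.mul_left)
  have hpart : ∀ i : Fin (k + 1),
      weakPartial (fun x => u x ((Fin.succAboveOrderEmb i).trans K)) (K i) φ =
        ∫ x, fderiv ℝ (fun y => u y ((Fin.succAboveOrderEmb i).trans K)) x
          (EuclideanSpace.single (K i) 1) * φ x := by
    intro i
    have hcont := (contDiff_coord hu ((Fin.succAboveOrderEmb i).trans K))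
    rw [weakPartial, integral_mul_fderiv_eq_neg_fderiv_mul_of_integrable (hint i), neg_neg]
    · exact locInt_mul_fderiv (hcont.continuous.locallyIntegrable) hφ hφc _
    · exact locInt_mul (hcont.continuous.locallyIntegrable) hφ.continuous hφc
    · exact fun x _ => hcont.differentiable (by simp) x
    · exact fun x _ => hφ.differentiable (by simp) x
  simp only [smoothD, Finset.sum_mul, mul_assoc, hpart]
  rw [integral_finsetSum _ fun i _ => (hint i).const_mul _]
  simp only [integral_const_mul]

theorem mem_maxGraph_of_smooth {μ : Measure (Space n)} [IsFiniteMeasure μ]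
    {u : Space n → Form n k} (hu : ContDiff ℝ (⊤ : ℕ∞) u) (hc : HasCompactSupport u) :
    ((hu.continuous.memLp_of_hasCompactSupport hc).toLp u,
      ((continuous_smoothD hu).memLp_of_hasCompactSupport
        (hasCompactSupport_smoothD hc)).toLp (smoothD u)) ∈ maxGraph μ k :=
  ⟨u, smoothD u, hu.continuous.locallyIntegrable, (continuous_smoothD hu).locallyIntegrable,
    MemLp.coeFn_toLp (hu.continuous.memLp_of_hasCompactSupport hc),
    MemLp.coeFn_toLp ((continuous_smoothD hu).memLp_of_hasCompactSupport
      (hasCompactSupport_smoothD hc)), isWeakD_smoothD hu⟩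

/-- The domain contains the forms `φ dz^J` with `φ` a real test function. A form orthogonal to all
of them has coefficients whose `μ`-integrals against test functions vanish. -/
theorem dense_domain_d (μ : Measure (Space n)) [IsFiniteMeasure μ] :
    Dense ((d μ k).domain : Set (L2 μ k)) := by
  rw [Submodule.dense_iff_topologicalClosure_eq_top, Submodule.topologicalClosure_eq_top_iff,
    Submodule.eq_bot_iff]
  intro g hg
  have hJ : ∀ J : Fin k ↪o Fin n, ∀ᵐ x ∂μ, g x J = 0 := by
    intro J
    have hgi : Integrable (fun x => g x) μ := (Lp.memLp g).integrable (by norm_num)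
    refine ae_eq_zero_of_integral_contDiff_smul_eq_zero
      ((EuclideanSpace.proj (𝕜 := ℂ) J).integrable_comp hgi).locallyIntegrable
      fun φ hφ hφc => ?_
    let u : Space n → Form n k := fun x => φ x • EuclideanSpace.single J 1
    have hu : ContDiff ℝ (⊤ : ℕ∞) u := hφ.smul contDiff_const
    have hc : HasCompactSupport u := hφc.smul_right
    have hmem : (hu.continuous.memLp_of_hasCompactSupport hc).toLp u ∈ (d μ k).domain :=
      ⟨_, mem_maxGraph_of_smooth hu hc, rfl⟩
    have h0 := (Submodule.mem_orthogonal _ _).1 hg _ hmem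
    rw [L2.inner_def] at h0
    rw [← h0]
    refine integral_congr_ae ?_
    filter_upwards [(hu.continuous.memLp_of_hasCompactSupport (μ := μ) (p := 2) hc).coeFn_toLp]
      with x hx
    have hux : u x = (φ x : ℂ) • EuclideanSpace.single J (1 : ℂ) := (Complex.coe_smul _ _).symm
    rw [hx, hux, inner_smul_left, EuclideanSpace.inner_single_left]
    simp
  rw [Lp.eq_zero_iff_ae_eq_zero]
  filter_upwards [ae_all_iff.2 hJ] with x hx
  ext J
  exact hx J

theorem contDiff_partial {φ : Space n → ℂ} (hφ : ContDiff ℝ (⊤ : ℕ∞) φ) (e : Space n) :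
    ContDiff ℝ (⊤ : ℕ∞) fun x => fderiv ℝ φ x e :=
  (hφ.fderiv_right (by simp)).clm_apply contDiff_const

theorem partial_comm {φ : Space n → ℂ} (hφ : ContDiff ℝ (⊤ : ℕ∞) φ) (e e' x : Space n) :
    fderiv ℝ (fun y => fderiv ℝ φ y e) x e' = fderiv ℝ (fun y => fderiv ℝ φ y e') x e := by
  have hd : DifferentiableAt ℝ (fderiv ℝ φ) x :=
    (hφ.fderiv_right (m := (⊤ : ℕ∞)) (by simp)).differentiable (by simp) x
  rw [fderiv_clm_apply hd (differentiableAt_const _), fderiv_clm_apply hd (differentiableAt_const _)]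
  have := (hφ.contDiffAt (x := x)).isSymmSndFDerivAt
    (by rw [minSmoothness_of_isRCLikeNormedField]; exact WithTop.coe_le_coe.2 le_top) e' e
  simpa using this

/-- Moving both derivatives onto `φ` leaves a signed sum over the ordered ways to delete two indices
from `K`. Exchanging the order of deletion preserves the integral, since second derivatives commute,
and reverses the sign. -/
theorem isWeakD_zero_of_isWeakD {u : Space n → Form n k} {f : Space n → Form n (k + 1)}
    (h : IsWeakD u f) : IsWeakD f (0 : Space n → Form n (k + 1 + 1)) := by
  intro φ hφ hφc K
  let a : Fin (k + 2) × Fin (k + 1) → ℂ := fun p =>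
    ∫ x, u x ((Fin.succAboveOrderEmb p.2).trans ((Fin.succAboveOrderEmb p.1).trans K)) *
      fderiv ℝ (fun y => fderiv ℝ φ y (EuclideanSpace.single (K p.1) 1)) x
        (EuclideanSpace.single (K (p.1.succAbove p.2)) 1)
  have hw : ∀ i : Fin (k + 2),
      weakPartial (fun x => f x ((Fin.succAboveOrderEmb i).trans K)) (K i) φ =
        ∑ l : Fin (k + 1), (-1 : ℂ) ^ (l : ℕ) * a (i, l) := by
    intro i
    rw [weakPartial, h _ (contDiff_partial hφ _) (hφc.fderiv_apply (𝕜 := ℝ) _),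
      ← Finset.sum_neg_distrib]
    refine Finset.sum_congr rfl fun l _ => ?_
    rw [weakPartial, mul_neg, neg_neg]
    rfl
  -- Deletes the same two indices in the opposite order.
  let σ : Fin (k + 2) × Fin (k + 1) → Fin (k + 2) × Fin (k + 1) := fun p =>
    (p.1.succAbove p.2, p.2.predAbove p.1)
  have ha : ∀ p, a (σ p) = a p := by
    rintro ⟨i, l⟩
    have hK : (Fin.succAboveOrderEmb (l.predAbove i)).trans
        ((Fin.succAboveOrderEmb (i.succAbove l)).trans K) =
        (Fin.succAboveOrderEmb l).trans ((Fin.succAboveOrderEmb i).trans K) := by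
      ext m
      simp [Fin.succAbove_succAbove_succAbove_predAbove]
    simp only [a, σ, hK, Fin.succAbove_succAbove_predAbove]
    refine integral_congr_ae (Eventually.of_forall fun x => ?_)
    simp only
    rw [partial_comm hφ]
  have hsum : ∑ p : Fin (k + 2) × Fin (k + 1),
      (-1 : ℂ) ^ (p.1 : ℕ) * ((-1 : ℂ) ^ (p.2 : ℕ) * a p) = 0 := by
    refine Finset.sum_involution (fun p _ => σ p) (fun p _ => ?_) (fun p _ _ => ?_)
      (fun _ _ => Finset.mem_univ _) (fun p _ => ?_)
    · rw [ha, ← mul_assoc, ← mul_assoc, ← pow_add, ← pow_add,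
        Fin.neg_one_pow_succAbove_add_predAbove]
      ring
    · exact fun h => Fin.succAbove_ne p.1 p.2 (congrArg Prod.fst h)
    · exact Prod.ext (Fin.succAbove_succAbove_predAbove _ _)
        (Fin.predAbove_predAbove_succAbove _ _)
  simp only [hw, Finset.mul_sum]
  rw [← Finset.sum_product', Finset.univ_product_univ, hsum]
  simp

/-- A class in `L²(μ)` may have representatives that differ as distributions. The one that witnesses
`d u = f` also serves for `d f = 0`. -/
theorem mem_maxGraph_succ {μ : Measure (Space n)} {u : L2 μ k} {f : L2 μ (k + 1)}
    (h : (u, f) ∈ maxGraph μ k) : (f, 0) ∈ maxGraph μ (k + 1) := by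
  obtain ⟨u', f', -, hf', -, hff, hD⟩ := h
  exact ⟨f', 0, hf', locallyIntegrable_zero, hff, Lp.coeFn_zero _ _ _, isWeakD_zero_of_isWeakD hD⟩

variable {μ : Measure (Space n)}

theorem graph_d (h : IsClosedOperator μ k) : (d μ k).graph = maxGraph μ k :=
  Submodule.toLinearPMap_graph_eq _ fun ⟨u, f⟩ hx hu => by
    obtain rfl : u = 0 := hu
    exact h.1 f hx

theorem isAdjointPair_d [IsFiniteMeasure μ] (h : IsClosedOperator μ k) :
    UnboundedOp.IsAdjointPair (d μ k) (dStar μ k) :=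
  .of_isClosed (dense_domain_d μ) (by rw [graph_d h]; exact h.2)

theorem range_d_le_ker (h : IsClosedOperator μ k) (h' : IsClosedOperator μ (k + 1)) :
    UnboundedOp.range (d μ k) ≤ UnboundedOp.ker (d μ (k + 1)) := by
  intro f hf
  obtain ⟨u, hu⟩ := UnboundedOp.mem_range_iff.1 hf
  rw [graph_d h] at hu
  rw [UnboundedOp.mem_ker_iff, graph_d h']
  exact mem_maxGraph_succ hu

end DeRham

namespace UnboundedOp

/-! ### Cutting an adjoint pair down to the orthogonal complements of the kernels. -/

section Compression

variable {E F : Type*}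
  [NormedAddCommGroup E] [InnerProductSpace ℂ E]
  [NormedAddCommGroup F] [InnerProductSpace ℂ F]

/-- The operator from `N` to `K` whose graph is the part of the graph of `T` in `N × K`. -/
noncomputable def compression (T : E →ₗ.[ℂ] F) (N : Submodule ℂ E) (K : Submodule ℂ F) :
    N →ₗ.[ℂ] K :=
  (T.graph.comap (N.subtype.prodMap K.subtype)).toLinearPMap

theorem mem_graph_compression {T : E →ₗ.[ℂ] F} {N : Submodule ℂ E} {K : Submodule ℂ F}
    {x : N} {y : K} : (x, y) ∈ (compression T N K).graph ↔ ((x : E), (y : F)) ∈ T.graph := by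
  rw [compression, Submodule.toLinearPMap_graph_eq]
  · rfl
  · rintro ⟨x, y⟩ hx hx0
    obtain rfl : x = 0 := hx0
    exact Subtype.ext (T.graph_fst_eq_zero_snd hx rfl)

theorem graph_snd_unique {T : E →ₗ.[ℂ] F} {x : E} {y z : F} (hy : (x, y) ∈ T.graph)
    (hz : (x, z) ∈ T.graph) : y = z :=
  T.mem_graph_snd_inj hy hz rfl

theorem sub_mem_ker {T : E →ₗ.[ℂ] F} {x y : E} {z : F} (hx : (x, z) ∈ T.graph)
    (hy : (y, z) ∈ T.graph) : x - y ∈ ker T := by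
  rw [mem_ker_iff]
  simpa using T.graph.sub_mem hx hy

theorem isClosed_ker {T : E →ₗ.[ℂ] F} (hT : IsClosed (T.graph : Set (E × F))) :
    IsClosed (ker T : Set E) := by
  have : (ker T : Set E) = (fun x => (x, (0 : F))) ⁻¹' (T.graph : Set (E × F)) := by
    ext x
    exact mem_ker_iff
  rw [this]
  exact hT.preimage (by fun_prop)

theorem isClosed_map_subtype_iff {K : Submodule ℂ E} (hK : IsClosed (K : Set E))
    {W : Submodule ℂ K} (hW : W.topologicalClosure = ⊤) :
    IsClosed (W.map K.subtype : Set E) ↔ W = ⊤ := by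
  constructor
  · intro h
    have hc : IsClosed (W : Set K) := by
      have := h.preimage (continuous_subtype_val (p := (· ∈ K)))
      convert this using 1
      ext x
      simp
    rw [← hW, hc.submodule_topologicalClosure_eq]
  · rintro rfl
    rwa [Submodule.map_subtype_top]

namespace IsAdjointPair

variable {T : E →ₗ.[ℂ] F} {T' : F →ₗ.[ℂ] E}

theorem range_le (h : IsAdjointPair T T') : range T' ≤ (ker T)ᗮ := by
  intro x hx
  obtain ⟨y, hy⟩ := mem_range_iff.1 hx
  refine (Submodule.mem_orthogonal _ _).2 fun z hz => ?_
  rw [← h.inner_eq (mem_ker_iff.1 hz) hy, inner_zero_left]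

theorem ker_eq (h : IsAdjointPair T T') : ker T' = (range T)ᗮ := by
  ext y
  rw [mem_ker_iff, h.right_iff, Submodule.mem_orthogonal]
  constructor
  · intro hy b hb
    obtain ⟨a, hab⟩ := mem_range_iff.1 hb
    rw [hy a b hab, inner_zero_right]
  · intro hy a b hab
    rw [hy b (mem_range_iff.2 ⟨a, hab⟩), inner_zero_right]

theorem closure_range_eq [CompleteSpace F] (h : IsAdjointPair T T') :
    (range T).topologicalClosure = (ker T')ᗮ := by
  rw [h.ker_eq, Submodule.orthogonal_orthogonal_eq_closure]

theorem compression_injective {N : Submodule ℂ E} {K : Submodule ℂ F}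
    (hN : N = (ker T)ᗮ) (x : N) (hx : (x, (0 : K)) ∈ (UnboundedOp.compression T N K).graph) :
    x = 0 := by
  subst hN
  have h₁ : (x : E) ∈ ker T := mem_ker_iff.2 (mem_graph_compression.1 hx)
  exact Subtype.ext (inner_self_eq_zero (𝕜 := ℂ).1 ((Submodule.mem_orthogonal _ _).1 x.2 _ h₁))

variable [CompleteSpace E]

theorem exists_mem_ker_orthogonal (h : IsAdjointPair T T') {a : E} {b : F}
    (hab : (a, b) ∈ T.graph) : ∃ a₁ ∈ (ker T)ᗮ, (a₁, b) ∈ T.graph ∧ a - a₁ ∈ ker T := by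
  have : CompleteSpace (ker T) := (isClosed_ker h.isClosed_graph).completeSpace_coe
  obtain ⟨a₀, h₀, a₁, h₁, rfl⟩ := (ker T).exists_add_mem_mem_orthogonal a
  refine ⟨a₁, h₁, ?_, by rwa [add_sub_cancel_right]⟩
  simpa using T.graph.sub_mem hab (mem_ker_iff.1 h₀)

/-- Removing from `a` its component in `ker T` changes neither `b = T a` nor the pairing with `x ⊥
ker T`. Testing on `N` is therefore as good as testing on the whole domain. -/
theorem compression_right_iff (h : IsAdjointPair T T') {N : Submodule ℂ E} {K : Submodule ℂ F}
    (hN : N = (ker T)ᗮ) (hK : K = (ker T')ᗮ) (y : K) (x : N) :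
    (y, x) ∈ (compression T' K N).graph ↔
      ∀ a b, (a, b) ∈ (compression T N K).graph → inner ℂ b y = inner ℂ a x := by
  subst hN hK
  rw [mem_graph_compression, h.right_iff]
  constructor
  · intro hyx a b hab
    exact hyx a b (mem_graph_compression.1 hab)
  · intro hyx a b hab
    obtain ⟨a₁, h₁, h₂, h₃⟩ := h.exists_mem_ker_orthogonal hab
    have := hyx ⟨a₁, h₁⟩ ⟨b, h.symm.range_le (mem_range_iff.2 ⟨a, hab⟩)⟩
      (mem_graph_compression.2 h₂)
    have h₄ : inner ℂ (a - a₁) (x : E) = 0 := (Submodule.mem_orthogonal _ _).1 x.2 _ h₃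
    rw [inner_sub_left, sub_eq_zero] at h₄
    rw [h₄]
    exact this

variable [CompleteSpace F]

theorem compression (h : IsAdjointPair T T') {N : Submodule ℂ E} {K : Submodule ℂ F}
    (hN : N = (ker T)ᗮ) (hK : K = (ker T')ᗮ) :
    IsAdjointPair (compression T N K) (compression T' K N) :=
  ⟨h.compression_right_iff hN hK, h.symm.compression_right_iff hK hN⟩

end IsAdjointPair

theorem map_range_compression {T : E →ₗ.[ℂ] F} {N : Submodule ℂ E} {K : Submodule ℂ F}
    (hK : range T ≤ K) (hN : ∀ a b, (a, b) ∈ T.graph → ∃ a₁ ∈ N, (a₁, b) ∈ T.graph) :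
    (range (compression T N K)).map K.subtype = range T := by
  ext y
  constructor
  · rintro ⟨z, hz, rfl⟩
    obtain ⟨x, hx⟩ := mem_range_iff.1 hz
    exact mem_range_iff.2 ⟨x, mem_graph_compression.1 hx⟩
  · intro hy
    obtain ⟨a, ha⟩ := mem_range_iff.1 hy
    obtain ⟨a₁, h₁, h₂⟩ := hN a y ha
    exact ⟨⟨y, hK hy⟩, mem_range_iff.2 ⟨⟨a₁, h₁⟩, mem_graph_compression.2 h₂⟩, rfl⟩

theorem mem_graph_comp_compression {T : E →ₗ.[ℂ] F} {T' : F →ₗ.[ℂ] E} {N : Submodule ℂ E}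
    {K : Submodule ℂ F} (hK : range T ≤ K) {x y : N} :
    (x, y) ∈ (comp (compression T' K N) (compression T N K)).graph ↔
      ((x : E), (y : E)) ∈ (comp T' T).graph := by
  rw [mem_graph_comp, mem_graph_comp]
  constructor
  · rintro ⟨z, h₁, h₂⟩
    exact ⟨z, mem_graph_compression.1 h₁, mem_graph_compression.1 h₂⟩
  · rintro ⟨z, h₁, h₂⟩
    exact ⟨⟨z, hK (mem_range_iff.2 ⟨_, h₁⟩)⟩, mem_graph_compression.2 h₁, mem_graph_compression.2 h₂⟩

end Compression

end UnboundedOp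

/-! ### The reduced differential and the equivalent properties. -/

namespace DeRham

open UnboundedOp

variable {n k : ℕ} {μ : Measure (Space n)}

theorem closed_X : IsClosed (X μ k : Set (L2 μ (k + 1))) :=
  Submodule.isClosed_topologicalClosure _

theorem completeSpace_X : CompleteSpace (X μ k) := closed_X.completeSpace_coe

theorem closed_kerPerp : IsClosed (kerPerp μ k : Set (L2 μ k)) :=
  Submodule.isClosed_orthogonal _

theorem range_d_le_X : range (d μ k) ≤ X μ k := Submodule.le_topologicalClosure _

/-- `d_k` as an operator from `Z(d_k)^⊥` to `X_{k+1}`. -/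
noncomputable def reducedD (μ : Measure (Space n)) (k : ℕ) : kerPerp μ k →ₗ.[ℂ] X μ k :=
  compression (d μ k) (kerPerp μ k) (X μ k)

/-- `d_k^*` as an operator from `X_{k+1}` to `Z(d_k)^⊥`. -/
noncomputable def reducedDStar (μ : Measure (Space n)) (k : ℕ) : X μ k →ₗ.[ℂ] kerPerp μ k :=
  compression (dStar μ k) (X μ k) (kerPerp μ k)

theorem mem_graph_reducedD {x : kerPerp μ k} {y : X μ k} :
    (x, y) ∈ (reducedD μ k).graph ↔ ((x : L2 μ k), (y : L2 μ (k + 1))) ∈ (d μ k).graph :=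
  mem_graph_compression

theorem mem_graph_reducedDStar {x : kerPerp μ k} {y : X μ k} :
    (y, x) ∈ (reducedDStar μ k).graph ↔
      ((y : L2 μ (k + 1)), (x : L2 μ k)) ∈ (dStar μ k).graph :=
  mem_graph_compression

theorem reducedD_injective (x : kerPerp μ k) (hx : (x, (0 : X μ k)) ∈ (reducedD μ k).graph) :
    x = 0 :=
  IsAdjointPair.compression_injective rfl x hx

theorem mem_graph_hodge_of_mem_X (hX : X μ k ≤ ker (d μ (k + 1))) {x y : L2 μ (k + 1)}
    (hx : x ∈ X μ k) : (x, y) ∈ (hodge μ (k + 1)).graph ↔ (x, y) ∈ (dDStar μ k).graph := by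
  have h0 : (x, 0) ∈ (dStarD μ (k + 1)).graph :=
    mem_graph_comp.2 ⟨0, mem_ker_iff.1 (hX hx), (dStar μ (k + 1)).graph.zero_mem⟩
  rw [hodge, mem_graph_add]
  constructor
  · rintro ⟨a, b, ha, hb, rfl⟩
    rwa [graph_snd_unique ha h0, zero_add]
  · exact fun h => ⟨0, y, h0, h, zero_add y⟩

theorem upper_eq_part (hX : X μ k ≤ ker (d μ (k + 1))) :
    upper μ k = part (dDStar μ k) (X μ k) :=
  ext_graph fun x y => by
    rw [upper, mem_graph_part, mem_graph_part, mem_graph_hodge_of_mem_X hX x.2]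

theorem lower_eq_conj {U : kerPerp μ k ≃ₗᵢ[ℂ] X μ k}
    (hU : ∀ x y, (x, y) ∈ (lower μ k).graph ↔ (U x, U y) ∈ (upper μ k).graph) :
    lower μ k = comp (total (U.symm.toLinearEquiv : _ →ₗ[ℂ] kerPerp μ k))
      (comp (upper μ k) (total (U.toLinearEquiv : _ →ₗ[ℂ] X μ k))) := by
  refine ext_graph fun x y => ?_
  simp only [mem_graph_comp, mem_graph_total]
  rw [hU]
  constructor
  · exact fun h => ⟨U y, ⟨U x, rfl, h⟩, U.symm_apply_apply y⟩
  · rintro ⟨w, ⟨q, rfl, h⟩, rfl⟩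
    have : U ((U.symm.toLinearEquiv : _ →ₗ[ℂ] kerPerp μ k) w) = w := U.apply_symm_apply w
    rw [this]
    exact h

variable [IsFiniteMeasure μ]

theorem X_le_ker (h : IsClosedOperator μ k) (h' : IsClosedOperator μ (k + 1)) :
    X μ k ≤ ker (d μ (k + 1)) :=
  Submodule.topologicalClosure_minimal _ (range_d_le_ker h h')
    (isClosed_ker (isAdjointPair_d h').isClosed_graph)

/-- As `R(d_{k-1}) ⊆ Z(d_k)`, such an `x` is annihilated by `d_{k-1}^*`, so it lies in the domain of
the second term and that term vanishes. The bounds on `j` select `k - 1`, `k`, `k + 1` without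
truncated subtraction, which leaves only `0` and `1` when `k = 0`. -/
theorem mem_graph_hodge_of_mem_kerPerp
    (hd : ∀ j : ℕ, k ≤ j + 1 → j ≤ k + 1 → IsClosedOperator μ j) {x y : L2 μ k}
    (hx : x ∈ kerPerp μ k) : (x, y) ∈ (hodge μ k).graph ↔ (x, y) ∈ (dStarD μ k).graph := by
  cases k with
  | zero => rfl
  | succ m =>
    have hm := hd m le_rfl (by omega)
    have h0 : (x, 0) ∈ (dDStar μ m).graph := by
      refine mem_graph_comp.2 ⟨0, ?_, (d μ m).graph.zero_mem⟩
      rw [← mem_ker_iff, (isAdjointPair_d hm).ker_eq]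
      exact Submodule.orthogonal_le (range_d_le_ker hm (hd (m + 1) (by omega) (by omega))) hx
    rw [hodge, mem_graph_add]
    constructor
    · rintro ⟨a, b, ha, hb, rfl⟩
      rwa [graph_snd_unique hb h0, add_zero]
    · exact fun h => ⟨y, 0, h, h0, add_zero y⟩

theorem range_dStar_le (h : IsClosedOperator μ k) : range (dStar μ k) ≤ kerPerp μ k :=
  (isAdjointPair_d h).range_le

theorem range_dStarD_le (h : IsClosedOperator μ k) : range (dStarD μ k) ≤ kerPerp μ k := by
  intro y hy
  obtain ⟨x, hx⟩ := mem_range_iff.1 hy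
  obtain ⟨z, -, hz⟩ := mem_graph_comp.1 hx
  exact range_dStar_le h (mem_range_iff.2 ⟨z, hz⟩)

theorem exists_mem_kerPerp (h : IsClosedOperator μ k) {a : L2 μ k} {b : L2 μ (k + 1)}
    (hab : (a, b) ∈ (d μ k).graph) :
    ∃ a₁ ∈ kerPerp μ k, (a₁, b) ∈ (d μ k).graph ∧ a - a₁ ∈ ker (d μ k) :=
  (isAdjointPair_d h).exists_mem_ker_orthogonal hab

/-- In `y = a + b`, the term `a` from `R(d_k^*)` is orthogonal to `Z(d_k)`, while `b` from
`R(d_{k-1})` lies in it. Hence `b = 0` when `y ⊥ Z(d_k)`, and the preimage may be projected onto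
`Z(d_k)^⊥`. -/
theorem exists_of_mem_range_hodge
    (hd : ∀ j : ℕ, k ≤ j + 1 → j ≤ k + 1 → IsClosedOperator μ j) {y : L2 μ k}
    (hy : y ∈ range (hodge μ k)) (hyp : y ∈ kerPerp μ k) :
    ∃ x ∈ kerPerp μ k, (x, y) ∈ (hodge μ k).graph := by
  have hk := hd k (by omega) (by omega)
  obtain ⟨x, hx⟩ := mem_range_iff.1 hy
  have hx' : (x, y) ∈ (dStarD μ k).graph := by
    cases k with
    | zero => exact hx
    | succ m =>
      rw [hodge, mem_graph_add] at hx
      obtain ⟨a, b, ha, hb, rfl⟩ := hx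
      have hap : a ∈ kerPerp μ (m + 1) := range_dStarD_le hk (mem_range_iff.2 ⟨x, ha⟩)
      have hbp : b ∈ kerPerp μ (m + 1) := by
        simpa using (kerPerp μ (m + 1)).sub_mem hyp hap
      obtain ⟨w, -, hw⟩ := mem_graph_comp.1 hb
      have hbk : b ∈ ker (d μ (m + 1)) :=
        range_d_le_ker (hd m le_rfl (by omega)) hk (mem_range_iff.2 ⟨w, hw⟩)
      have hb0 : b = 0 :=
        inner_self_eq_zero (𝕜 := ℂ).1 ((Submodule.mem_orthogonal _ _).1 hbp b hbk)
      rwa [hb0, add_zero]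
  obtain ⟨z, h₁, h₂⟩ := mem_graph_comp.1 hx'
  obtain ⟨x₁, hx₁, h₃, -⟩ := exists_mem_kerPerp hk h₁
  exact ⟨x₁, hx₁, (mem_graph_hodge_of_mem_kerPerp hd hx₁).2 (mem_graph_comp.2 ⟨z, h₃, h₂⟩)⟩

theorem lowerRange_eq_inf (hd : ∀ j : ℕ, k ≤ j + 1 → j ≤ k + 1 → IsClosedOperator μ j) :
    lowerRange μ k = range (hodge μ k) ⊓ kerPerp μ k := by
  ext y
  constructor
  · rintro ⟨z, hz, rfl⟩
    obtain ⟨x, hx⟩ := mem_range_iff.1 hz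
    exact ⟨mem_range_iff.2 ⟨x, mem_graph_part.1 hx⟩, z.2⟩
  · rintro ⟨hy, hyp⟩
    obtain ⟨x, hx, hxy⟩ := exists_of_mem_range_hodge hd hy hyp
    exact ⟨⟨y, hyp⟩, mem_range_iff.2 ⟨⟨x, hx⟩, mem_graph_part.2 hxy⟩, rfl⟩

theorem lower_eq_part (hd : ∀ j : ℕ, k ≤ j + 1 → j ≤ k + 1 → IsClosedOperator μ j) :
    lower μ k = part (dStarD μ k) (kerPerp μ k) :=
  ext_graph fun x y => by
    rw [lower, mem_graph_part, mem_graph_part, mem_graph_hodge_of_mem_kerPerp hd x.2]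

theorem lower_eq_comp (hd : ∀ j : ℕ, k ≤ j + 1 → j ≤ k + 1 → IsClosedOperator μ j) :
    lower μ k = comp (reducedDStar μ k) (reducedD μ k) :=
  ext_graph fun x y => by
    rw [lower_eq_part hd, mem_graph_part]
    exact (mem_graph_comp_compression range_d_le_X).symm

theorem upper_eq_comp (hX : X μ k ≤ ker (d μ (k + 1))) (h : IsClosedOperator μ k) :
    upper μ k = comp (reducedD μ k) (reducedDStar μ k) :=
  ext_graph fun x y => by
    rw [upper_eq_part hX, mem_graph_part]
    exact (mem_graph_comp_compression (range_dStar_le h)).symm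

theorem X_eq (h : IsClosedOperator μ k) : X μ k = (ker (dStar μ k))ᗮ :=
  (isAdjointPair_d h).closure_range_eq

theorem isAdjointPair_reducedD (h : IsClosedOperator μ k) :
    IsAdjointPair (reducedD μ k) (reducedDStar μ k) :=
  (isAdjointPair_d h).compression rfl (X_eq h)

theorem reducedDStar_injective (h : IsClosedOperator μ k) (y : X μ k)
    (hy : (y, (0 : kerPerp μ k)) ∈ (reducedDStar μ k).graph) : y = 0 :=
  IsAdjointPair.compression_injective (X_eq h) y hy

theorem map_range_reducedD (h : IsClosedOperator μ k) :
    (range (reducedD μ k)).map (X μ k).subtype = range (d μ k) :=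
  map_range_compression range_d_le_X fun _ _ hab =>
    let ⟨a₁, h₁, h₂, _⟩ := exists_mem_kerPerp h hab
    ⟨a₁, h₁, h₂⟩

theorem map_range_reducedDStar (h : IsClosedOperator μ k) :
    (range (reducedDStar μ k)).map (kerPerp μ k).subtype = range (dStar μ k) :=
  map_range_compression (range_dStar_le h) fun _ _ hab => by
    rw [X_eq h]
    obtain ⟨a₁, h₁, h₂, _⟩ := (isAdjointPair_d h).symm.exists_mem_ker_orthogonal hab
    exact ⟨a₁, h₁, h₂⟩

theorem range_comp_le {E F G : Type*}
    [NormedAddCommGroup E] [InnerProductSpace ℂ E] [NormedAddCommGroup F] [InnerProductSpace ℂ F]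
    [NormedAddCommGroup G] [InnerProductSpace ℂ G] (S : F →ₗ.[ℂ] G) (T : E →ₗ.[ℂ] F) :
    range (comp S T) ≤ range S := by
  intro y hy
  obtain ⟨x, hx⟩ := mem_range_iff.1 hy
  obtain ⟨z, -, hz⟩ := mem_graph_comp.1 hx
  exact mem_range_iff.2 ⟨z, hz⟩

theorem isClosed_lowerRange_iff (hd : ∀ j : ℕ, k ≤ j + 1 → j ≤ k + 1 → IsClosedOperator μ j) :
    IsClosed (lowerRange μ k : Set (L2 μ k)) ↔
      range (comp (reducedDStar μ k) (reducedD μ k)) = ⊤ := by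
  have hk := hd k (by omega) (by omega)
  have := completeSpace_X (μ := μ) (k := k)
  rw [← lower_eq_comp hd]
  refine isClosed_map_subtype_iff closed_kerPerp ?_
  have := (isAdjointPair_reducedD hk).symm.range_comp_dense reducedD_injective
  rwa [← lower_eq_comp hd] at this

theorem isClosed_range_d_iff (h : IsClosedOperator μ k) :
    IsClosed (range (d μ k) : Set (L2 μ (k + 1))) ↔ range (reducedD μ k) = ⊤ := by
  have := completeSpace_X (μ := μ) (k := k)
  rw [← map_range_reducedD h]
  refine isClosed_map_subtype_iff closed_X (top_le_iff.1 ?_)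
  rw [← (isAdjointPair_reducedD h).range_comp_dense (reducedDStar_injective h)]
  exact Submodule.topologicalClosure_mono (range_comp_le _ _)

theorem isClosed_range_dStar_iff (h : IsClosedOperator μ k) :
    IsClosed (range (dStar μ k) : Set (L2 μ k)) ↔ range (reducedDStar μ k) = ⊤ := by
  have := completeSpace_X (μ := μ) (k := k)
  rw [← map_range_reducedDStar h]
  refine isClosed_map_subtype_iff closed_kerPerp (top_le_iff.1 ?_)
  rw [← (isAdjointPair_reducedD h).symm.range_comp_dense reducedD_injective]
  exact Submodule.topologicalClosure_mono (range_comp_le _ _)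

theorem upper_graph_injective (hX : X μ k ≤ ker (d μ (k + 1))) (h : IsClosedOperator μ k)
    (x : X μ k) (hx : (x, (0 : X μ k)) ∈ (upper μ k).graph) : x = 0 := by
  rw [upper_eq_comp hX h] at hx
  obtain ⟨a, h₁, h₂⟩ := mem_graph_comp.1 hx
  rw [reducedD_injective a h₂] at h₁
  exact reducedDStar_injective h x h₁

theorem mem_graph_projFormula (hX : X μ k ≤ ker (d μ (k + 1))) (h : IsClosedOperator μ k)
    {x z : L2 μ k} : (x, z) ∈ (projFormula μ k).graph ↔
      ∃ t s : X μ k, (x, (s : L2 μ (k + 1))) ∈ (d μ k).graph ∧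
        (t, s) ∈ (comp (reducedD μ k) (reducedDStar μ k)).graph ∧
        ((t : L2 μ (k + 1)), z) ∈ (dStar μ k).graph := by
  rw [projFormula, mem_graph_comp, ← upper_eq_comp hX h]
  simp only [mem_graph_comp, mem_graph_inverse (upper_graph_injective hX h),
    mem_graph_total]
  constructor
  · rintro ⟨t, ⟨s, h₁, h₂⟩, t', rfl, h₃⟩
    exact ⟨t, s, mem_graph_codRestrict.1 h₁, h₂, h₃⟩
  · rintro ⟨t, s, h₁, h₂, h₃⟩
    exact ⟨t, ⟨s, mem_graph_codRestrict.2 h₁, h₂⟩, t, rfl, h₃⟩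

/-- Equality of the domains alone forces `R(S) ⊆ R(S S')`. Conversely, this inclusion makes `S' S`
onto, so `P` projects onto `Z(d_k)^⊥`; and `S' (S S')⁻¹ S` is the identity on the domain of `S`,
because `S` is injective. -/
theorem projFormula_eq_iff (hd : ∀ j : ℕ, k ≤ j + 1 → j ≤ k + 1 → IsClosedOperator μ j) :
    projFormula μ k = (P μ k : L2 μ k →ₗ[ℂ] L2 μ k).toPMap (d μ k).domain ↔
      range (reducedD μ k) ≤ range (comp (reducedD μ k) (reducedDStar μ k)) := by
  have hk := hd k (by omega) (by omega)
  have hX := X_le_ker hk (hd (k + 1) (by omega) le_rfl)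
  have hp := isAdjointPair_reducedD hk
  have := completeSpace_X (μ := μ) (k := k)
  constructor
  · intro he s hs
    obtain ⟨a, ha⟩ := mem_range_iff.1 hs
    have ha := mem_graph_reducedD.1 ha
    have hP : ((a : L2 μ k), P μ k a) ∈ (projFormula μ k).graph := by
      rw [he, mem_graph_toPMap]
      exact ⟨LinearPMap.mem_domain_of_mem_graph ha, rfl⟩
    obtain ⟨t, s', h₁, h₂, -⟩ := (mem_graph_projFormula hX hk).1 hP
    rw [Subtype.ext (graph_snd_unique ha h₁)]
    exact mem_range_iff.2 ⟨t, h₂⟩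
  · intro hr
    have htop : range (comp (reducedDStar μ k) (reducedD μ k)) = ⊤ :=
      ((hp.tfae_surjective reducedD_injective (reducedDStar_injective hk)).out 4 0).1 hr
    have hcl : (lowerRange μ k).topologicalClosure = kerPerp μ k := by
      have : lowerRange μ k = kerPerp μ k := by
        rw [lowerRange, partRange, ← lower, lower_eq_comp hd, htop, Submodule.map_subtype_top]
      rw [this]
      exact closed_kerPerp.submodule_topologicalClosure_eq
    have hP : ∀ {x a : L2 μ k}, a ∈ kerPerp μ k → x - a ∈ ker (d μ k) → P μ k x = a := by
      intro x a ha hxa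
      refine Submodule.eq_starProjection_of_mem_orthogonal (hcl ▸ ha) ?_
      rw [hcl]
      exact Submodule.le_orthogonal_orthogonal _ hxa
    refine ext_graph fun x z => ?_
    rw [mem_graph_projFormula hX hk, mem_graph_toPMap]
    constructor
    · rintro ⟨t, s, h₁, h₂, h₃⟩
      obtain ⟨a, h₄, h₅⟩ := mem_graph_comp.1 h₂
      refine ⟨LinearPMap.mem_domain_of_mem_graph h₁, ?_⟩
      rw [graph_snd_unique h₃ (mem_graph_reducedDStar.1 h₄)]
      exact hP a.2 (sub_mem_ker h₁ (mem_graph_reducedD.1 h₅))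
    · rintro ⟨hx, rfl⟩
      have h₁ := (d μ k).mem_graph ⟨x, hx⟩
      obtain ⟨a, ha, h₂, h₃⟩ := exists_mem_kerPerp hk h₁
      let s : X μ k := ⟨d μ k ⟨x, hx⟩, range_d_le_X (LinearMap.mem_range_self _ _)⟩
      have hs : ((⟨a, ha⟩ : kerPerp μ k), s) ∈ (reducedD μ k).graph := mem_graph_reducedD.2 h₂
      obtain ⟨t, ht⟩ := mem_range_iff.1 (hr (mem_range_iff.2 ⟨_, hs⟩))
      obtain ⟨a', h₄, h₅⟩ := mem_graph_comp.1 ht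
      have haa : a' = ⟨a, ha⟩ := sub_eq_zero.1
        (reducedD_injective _ (by simpa using (reducedD μ k).graph.sub_mem h₅ hs))
      rw [haa] at h₄
      refine ⟨t, s, h₁, ht, ?_⟩
      have : (P μ k : L2 μ k →ₗ[ℂ] L2 μ k) x = a := hP ha h₃
      rw [this]
      exact mem_graph_reducedDStar.1 h₄

theorem tfae_closed_range (hd : ∀ j : ℕ, k ≤ j + 1 → j ≤ k + 1 → IsClosedOperator μ j) :
    List.TFAE [
      IsClosed (lowerRange μ k : Set (L2 μ k)),
      IsClosed (range (d μ k) : Set (L2 μ (k + 1))),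
      IsClosed (range (dStar μ k) : Set (L2 μ k)),
      IsStrictlyPositive (upper μ k),
      projFormula μ k = (P μ k : L2 μ k →ₗ[ℂ] L2 μ k).toPMap (d μ k).domain] := by
  have hk := hd k (by omega) (by omega)
  have := completeSpace_X (μ := μ) (k := k)
  rw [isClosed_lowerRange_iff hd, isClosed_range_d_iff hk, isClosed_range_dStar_iff hk,
    projFormula_eq_iff hd, upper_eq_comp (X_le_ker hk (hd (k + 1) (by omega) le_rfl)) hk]
  exact (isAdjointPair_reducedD hk).tfae_surjective reducedD_injective (reducedDStar_injective hk)

end DeRham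

/-! ### The square root, the unitary equivalence and the theorem. -/

namespace UnboundedOp

variable {E F : Type*}
  [NormedAddCommGroup E] [InnerProductSpace ℂ E] [CompleteSpace E]
  [NormedAddCommGroup F] [InnerProductSpace ℂ F] [CompleteSpace F]

theorem IsAdjointPair.exists_sqrt_and_unitary {S : E →ₗ.[ℂ] F} {S' : F →ₗ.[ℂ] E}
    (h : IsAdjointPair S S') (hinj : ∀ x, (x, (0 : F)) ∈ S.graph → x = 0)
    (hsurj : range S = ⊤) :
    ∃ Q : E →ₗ.[ℂ] E, IsSqrt (comp S' S) Q ∧ (∀ Q', IsSqrt (comp S' S) Q' → Q' = Q) ∧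
      (∀ x, (x, (0 : E)) ∈ Q.graph → x = 0) ∧
      ∃ U : E ≃ₗᵢ[ℂ] F, (∀ x, ∃ y, (y, x) ∈ Q.graph ∧ (y, U x) ∈ S.graph) ∧
        ∀ x y, (x, y) ∈ (comp S' S).graph ↔ (U x, U y) ∈ (comp S S').graph := by
  obtain ⟨K, hK⟩ := exists_bounded_inverse h.isClosed_graph hinj (range_eq_top_iff.1 hsurj)
  have hK' : ∀ y x, (y, x) ∈ S'.graph ↔ y = ContinuousLinearMap.adjoint K x := by
    intro y x
    rw [h.right_iff]
    constructor
    · intro hyx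
      refine ext_inner_left ℂ fun b => ?_
      rw [hyx (K b) b ((hK _ _).2 rfl), ContinuousLinearMap.adjoint_inner_right]
    · rintro rfl a b hab
      rw [(hK a b).1 hab, ContinuousLinearMap.adjoint_inner_right]
  have hKinj : Function.Injective K := (injective_iff_map_eq_zero K).2 fun y hy =>
    S.graph_fst_eq_zero_snd ((hK 0 y).2 hy.symm) rfl
  have hKinj' : Function.Injective (ContinuousLinearMap.adjoint K) :=
    (injective_iff_map_eq_zero _).2 fun y hy =>
      S'.graph_fst_eq_zero_snd ((hK' 0 y).2 hy.symm) rfl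
  obtain ⟨H, U, hH, hHH, hKU, hUH⟩ := exists_polar_decomposition K hKinj hKinj'
  have hHinj : Function.Injective H := fun x y hxy =>
    hKinj' (by rw [hUH, hUH, hxy])
  -- As `S⁻¹ = K` and `S'⁻¹ = K^*`, the inverses are `(S' S)⁻¹ = K K^* = H²` and, in `hM`, `(S S')⁻¹
  -- = K^* K`. The relations `K U = H` and `K^* = U H` intertwine them.
  have hL : ∀ x y, (x, y) ∈ (comp S' S).graph ↔ x = (H * H) y := by
    intro x y
    rw [mem_graph_comp, hHH]
    constructor
    · rintro ⟨z, h₁, h₂⟩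
      rw [(hK x z).1 h₁, (hK' z y).1 h₂]
      rfl
    · rintro rfl
      exact ⟨ContinuousLinearMap.adjoint K y, (hK _ _).2 rfl, (hK' _ _).2 rfl⟩
  have hM : ∀ v w, (v, w) ∈ (comp S S').graph ↔ v = ContinuousLinearMap.adjoint K (K w) := by
    intro v w
    rw [mem_graph_comp]
    constructor
    · rintro ⟨z, h₁, h₂⟩
      rw [(hK' v z).1 h₁, (hK z w).1 h₂]
    · rintro rfl
      exact ⟨K w, (hK' _ _).2 rfl, (hK _ _).2 rfl⟩
  have hHg : ∀ x, (x, (0 : E)) ∈ (total (H : E →ₗ[ℂ] E)).graph → x = 0 := fun x hx =>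
    (injective_iff_map_eq_zero _).1 hHinj x (mem_graph_total.1 hx)
  have hQ : ∀ x y, (x, y) ∈ (total (H : E →ₗ[ℂ] E)).inverse.graph ↔ H y = x := fun x y => by
    rw [mem_graph_inverse hHg, mem_graph_total]
    rfl
  have hsq := isSqrt_inverse_total hH hHinj hL
  refine ⟨_, hsq, fun Q' hQ' => hsq.unique hQ' (fun x hx => ?_)
    (fun y => ⟨_, (hL _ _).2 rfl⟩), fun x hx => ?_, U, fun x => ⟨H x, (hQ _ _).2 rfl, ?_⟩,
    fun x y => ?_⟩
  · rw [(hL x 0).1 hx, map_zero]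
  · rw [← (hQ x 0).1 hx, map_zero]
  · rw [hK, hKU]
  · rw [hL, hM, hKU, hUH, U.injective.eq_iff]
    rfl

end UnboundedOp

namespace DeRham

open UnboundedOp

variable {n k : ℕ} {μ : Measure (Space n)} [IsFiniteMeasure μ]

/-- Equating `d_k Q⁻¹` with a total operator records that it is everywhere defined. -/
theorem exists_sqrt_and_unitary (hd : ∀ j : ℕ, k ≤ j + 1 → j ≤ k + 1 → IsClosedOperator μ j)
    (hr : IsClosed (range (d μ k) : Set (L2 μ (k + 1)))) :
    ∃ Q : kerPerp μ k →ₗ.[ℂ] kerPerp μ k,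
      IsSqrt (lower μ k) Q ∧ (∀ Q', IsSqrt (lower μ k) Q' → Q' = Q) ∧ Function.Injective Q ∧
      ∃ U : kerPerp μ k ≃ₗᵢ[ℂ] X μ k,
        comp (d μ k) (comp (total (kerPerp μ k).subtype) Q.inverse) =
          total ((X μ k).subtype ∘ₗ (U.toLinearEquiv : _ →ₗ[ℂ] X μ k)) ∧
        ∀ x y, (x, y) ∈ (lower μ k).graph ↔ (U x, U y) ∈ (upper μ k).graph := by
  have hk := hd k (by omega) (by omega)
  have := completeSpace_X (μ := μ) (k := k)
  have hX := X_le_ker hk (hd (k + 1) (by omega) le_rfl)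
  obtain ⟨Q, hQ, huniq, hQinj, U, hU, hUU⟩ :=
    (isAdjointPair_reducedD hk).exists_sqrt_and_unitary reducedD_injective
      ((isClosed_range_d_iff hk).1 hr)
  rw [lower_eq_comp hd, upper_eq_comp hX hk]
  refine ⟨Q, hQ, huniq, injective_iff_graph.2 hQinj, U, ext_graph fun x z => ?_, hUU⟩
  obtain ⟨y, h₁, h₂⟩ := hU x
  have h₂ := mem_graph_reducedD.1 h₂
  simp only [mem_graph_comp, mem_graph_total, mem_graph_inverse hQinj]
  constructor
  · rintro ⟨w, ⟨q, h₃, rfl⟩, h₄⟩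
    have hqy : q = y := sub_eq_zero.1 (hQinj _ (by simpa using Q.graph.sub_mem h₃ h₁))
    rw [hqy] at h₄
    exact graph_snd_unique h₂ h₄
  · rintro rfl
    exact ⟨y, ⟨y, h₁, rfl⟩, h₂⟩

theorem lowerRange_eq_range_dStar
    (hd : ∀ j : ℕ, k ≤ j + 1 → j ≤ k + 1 → IsClosedOperator μ j)
    (hr : IsClosed (range (d μ k) : Set (L2 μ (k + 1)))) : lowerRange μ k = range (dStar μ k) := by
  have hk := hd k (by omega) (by omega)
  have h₁ := (isClosed_lowerRange_iff hd).1 (((tfae_closed_range hd).out 1 0).1 hr)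
  have h₂ := (isClosed_range_dStar_iff hk).1 (((tfae_closed_range hd).out 1 2).1 hr)
  rw [lowerRange, partRange, ← lower, lower_eq_comp hd, h₁, ← map_range_reducedDStar hk, h₂]

end DeRham

theorem theorem1p1 (n k : ℕ) (μ : Measure (DeRham.Space n)) [IsProbabilityMeasure μ]
    (hd : ∀ j : ℕ, k ≤ j + 1 → j ≤ k + 1 → DeRham.IsClosedOperator μ j) :
    -- the restrictions make sense, and `A_{k+1}|_{X_{k+1}}` has an inverse
    UnboundedOp.IsInvariant (DeRham.hodge μ k) (DeRham.kerPerp μ k) ∧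
    UnboundedOp.IsInvariant (DeRham.hodge μ (k + 1)) (DeRham.X μ k) ∧
    Function.Injective (DeRham.upper μ k) ∧
    -- the equivalent properties
    List.TFAE [
      IsClosed (DeRham.lowerRange μ k : Set (DeRham.L2 μ k)),
      IsClosed (UnboundedOp.range (DeRham.d μ k) : Set (DeRham.L2 μ (k + 1))),
      IsClosed (UnboundedOp.range (DeRham.dStar μ k) : Set (DeRham.L2 μ k)),
      UnboundedOp.IsStrictlyPositive (DeRham.upper μ k),
      DeRham.projFormula μ k = (DeRham.P μ k : DeRham.L2 μ k →ₗ[ℂ] DeRham.L2 μ k).toPMap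
        (DeRham.d μ k).domain] ∧
    -- the range of `A_k` itself
    (IsClosed (UnboundedOp.range (DeRham.hodge μ k) : Set (DeRham.L2 μ k)) →
      IsClosed (DeRham.lowerRange μ k : Set (DeRham.L2 μ k))) ∧
    (k = 0 → UnboundedOp.range (DeRham.hodge μ k) = DeRham.lowerRange μ k) ∧
    -- the affirmative case
    (IsClosed (UnboundedOp.range (DeRham.d μ k) : Set (DeRham.L2 μ (k + 1))) →
      DeRham.lower μ k = UnboundedOp.part (DeRham.dStarD μ k) (DeRham.kerPerp μ k) ∧
      DeRham.lowerRange μ k = UnboundedOp.range (DeRham.dStar μ k) ∧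
      DeRham.upper μ k = UnboundedOp.part (DeRham.dDStar μ k) (DeRham.X μ k) ∧
      (∃ Q : DeRham.kerPerp μ k →ₗ.[ℂ] DeRham.kerPerp μ k,
        UnboundedOp.IsSqrt
          (UnboundedOp.part (DeRham.dStarD μ k) (DeRham.kerPerp μ k)) Q ∧
        (∀ Q', UnboundedOp.IsSqrt
          (UnboundedOp.part (DeRham.dStarD μ k) (DeRham.kerPerp μ k)) Q' → Q' = Q) ∧
        Function.Injective Q ∧
        ∃ U : DeRham.kerPerp μ k ≃ₗᵢ[ℂ] DeRham.X μ k,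
          UnboundedOp.comp (DeRham.d μ k)
              (UnboundedOp.comp (UnboundedOp.total (DeRham.kerPerp μ k).subtype) Q.inverse) =
            UnboundedOp.total
              ((DeRham.X μ k).subtype ∘ₗ (U.toLinearEquiv : _ →ₗ[ℂ] DeRham.X μ k)) ∧
          DeRham.lower μ k =
            UnboundedOp.comp
              (UnboundedOp.total (U.symm.toLinearEquiv : _ →ₗ[ℂ] DeRham.kerPerp μ k))
              (UnboundedOp.comp (DeRham.upper μ k)
                (UnboundedOp.total (U.toLinearEquiv : _ →ₗ[ℂ] DeRham.X μ k)))) ∧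
      UnboundedOp.spectrum (DeRham.lower μ k) = UnboundedOp.spectrum (DeRham.upper μ k) ∧
      UnboundedOp.essentialSpectrum (DeRham.lower μ k) =
        UnboundedOp.essentialSpectrum (DeRham.upper μ k)) := by
  have hk := hd k (by omega) (by omega)
  have hX := DeRham.X_le_ker hk (hd (k + 1) (by omega) le_rfl)
  have htfae := DeRham.tfae_closed_range hd
  have hinf := DeRham.lowerRange_eq_inf hd
  refine ⟨?_, ?_, ?_, htfae, fun h => ?_, ?_, fun hr => ?_⟩
  · rw [UnboundedOp.isInvariant_iff_graph]
    intro x y hxy hx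
    rw [DeRham.mem_graph_hodge_of_mem_kerPerp hd hx] at hxy
    exact DeRham.range_dStarD_le hk (UnboundedOp.mem_range_iff.2 ⟨x, hxy⟩)
  · rw [UnboundedOp.isInvariant_iff_graph]
    intro x y hxy hx
    rw [DeRham.mem_graph_hodge_of_mem_X hX hx] at hxy
    obtain ⟨z, -, hz⟩ := UnboundedOp.mem_graph_comp.1 hxy
    exact DeRham.range_d_le_X (UnboundedOp.mem_range_iff.2 ⟨z, hz⟩)
  · exact UnboundedOp.injective_iff_graph.2 (DeRham.upper_graph_injective hX hk)
  -- The range of the restriction is `R(A_k) ∩ Z(d_k)^⊥`, an intersection of closed sets.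
  · rw [hinf]
    exact h.inter DeRham.closed_kerPerp
  · rintro rfl
    rw [hinf]
    exact (inf_eq_left.2 (DeRham.range_dStarD_le hk)).symm
  · obtain ⟨Q, hQ, huniq, hQinj, U, hUd, hU⟩ := DeRham.exists_sqrt_and_unitary hd hr
    refine ⟨DeRham.lower_eq_part hd, DeRham.lowerRange_eq_range_dStar hd hr,
      DeRham.upper_eq_part hX, ⟨Q, ?_, ?_, hQinj, U, hUd, DeRham.lower_eq_conj hU⟩,
      UnboundedOp.spectrum_eq_of_unitary_equiv U hU,
      UnboundedOp.essentialSpectrum_eq_of_unitary_equiv U hU⟩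
    · rwa [← DeRham.lower_eq_part hd]
    · rwa [← DeRham.lower_eq_part hd]
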